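/- A compact metric graph $\mathcal G$ is a finite connected graph (multiple edges and self-loops allowed) in which every edge $e$ is identified with an interval $[0,L_e]$, $0<L_e<\infty$; $|\mathcal G|=\sum_e L_e$ is its total length. $H^1(\mathcal G)$ is the space of complex functions on $\mathcal G$ that are $H^1$ on every edge and continuous at the vertices. For $u\in H^1(\mathcal G)$ let $$E(u)=\frac12\int_{\mathcal G}|u'|^2\,dx-\frac1p\int_{\mathcal G}|u|^p\,dx,\qquad H^1_\mu(\mathcal G)=\{u\in H^1(\mathcal G):\ \|u\|_2^2=\mu\},$$ and for $\mu>0$ let $\kappa_\mu=\sqrt{\mu/|\mathcal G|}\in H^1_\mu(\mathcal G)$ be the constant function of mass $\mu$. Let $\mu_1(\mathcal G,p)$ be the threshold mass such that $\kappa_\mu$ is a local minimizer of $E$ in $H^1_\mu(\mathcal G)$ (in the $H^1$ norm) for $\mu<\mu_1(\mathcal G,p)$ and is not one for $\mu>\mu_1(\mathcal G,p)$; that is, $\mu_1(\mathcal G,p)$ is the supremum of the masses $\mu>0$ for which $\kappa_\mu$ is a local minimizer of $E$ in $H^1_\mu(\mathcal G)$. A terminal edge is an edge with an endpoint of degree $1$;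 a bridging edge is an edge whose removal disconnects the graph; a graph has a cycle covering if every edge lies on a cycle, i.e. on a closed path without repeated edges. **Theorem.** Let $(\mathcal G_\ell)_{\ell>0}$ be compact metric graphs with the same underlying finite connected graph, which has no terminal edge and no cycle covering, such that the lengths of the non-bridging edges do not depend on $\ell$ and the longest bridging edge of $\mathcal G_\ell$ has length $\ell$. (i) If the lengths of the bridging edges other than one of length $\ell$ stay bounded independently of $\ell$ (in particular, if there is only one bridging edge), then $$\lim_{\ell\to+\infty}\mu_1(\mathcal G_\ell,6)=\frac{\pi}{2}.$$ (ii) In all cases $$\liminf_{\ell\to0^+}\mu_1(\mathcal G_\ell,6)\ \ge\ \pi.$$ -/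

import Mathlib

open Set Filter Topology MeasureTheory

/-- The combinatorial part of a metric graph with vertex set `V` and edge set `E`: every edge has an
initial and a final vertex, so that it can be identified with an interval `[0, L e]`. Multiple edges
and self-loops are allowed; the orientation only serves to parametrize the edges. -/
structure MGraph (V E : Type*) where
  /-- the vertex at the coordinate `0` of an edge -/
  src : E → V
  /-- the vertex at the coordinate `L e` of an edge -/
  tgt : E → V

namespace MGraph

variable {V E : Type*}

/-- The two vertices are joined by a (possibly trivial) path, traversing edges of `S` in any
direction. -/
def JoinedIn (Γ : MGraph V E) (S : Set E) (x y : V) : Prop :=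
  Relation.EqvGen (fun a b => ∃ e ∈ S, Γ.src e = a ∧ Γ.tgt e = b) x y

/-- The graph is connected. -/
def IsConnected (Γ : MGraph V E) : Prop :=
  Nonempty V ∧ ∀ x y, Γ.JoinedIn Set.univ x y

/-- A bridging edge (of a connected graph): its removal disconnects the graph. -/
def IsBridging (Γ : MGraph V E) (e : E) : Prop :=
  ¬ ∀ x y, Γ.JoinedIn {e}ᶜ x y

/-- The degree of a vertex; a self-loop counts twice. -/
noncomputable def degree (Γ : MGraph V E) (x : V) : ℕ :=
  {e | Γ.src e = x}.ncard + {e | Γ.tgt e = x}.ncard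

/-- A terminal edge: one of its endpoints has degree one. -/
def IsTerminal (Γ : MGraph V E) (e : E) : Prop :=
  Γ.degree (Γ.src e) = 1 ∨ Γ.degree (Γ.tgt e) = 1

/-- The starting vertex of an edge traversed forwards (`true`) or backwards (`false`). -/
def dartStart (Γ : MGraph V E) (d : E × Bool) : V :=
  if d.2 then Γ.src d.1 else Γ.tgt d.1

/-- The final vertex of an edge traversed forwards (`true`) or backwards (`false`). -/
def dartEnd (Γ : MGraph V E) (d : E × Bool) : V :=
  if d.2 then Γ.tgt d.1 else Γ.src d.1

/-- A cycle, i.e. a closed path without edge repetitions. The index `i + 1` is cyclic in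
`Fin (n + 1)`, so the last edge ends where the first one starts. -/
structure IsCycle (Γ : MGraph V E) {n : ℕ} (d : Fin (n + 1) → E × Bool) : Prop where
  chain : ∀ i, Γ.dartEnd (d i) = Γ.dartStart (d (i + 1))
  no_repetition : Function.Injective (fun i => (d i).1)

/-- The graph admits a cycle covering: every edge lies on a cycle. -/
def HasCycleCovering (Γ : MGraph V E) : Prop :=
  ∀ e, ∃ (n : ℕ) (d : Fin (n + 1) → E × Bool), Γ.IsCycle d ∧ ∃ i, (d i).1 = e

/-- The complex Sobolev space `H¹` of the metric graph in which the edge `e` is the interval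
`[0, L e]`. An element is a function on the edges with its weak derivative: on every edge the weak
derivative is square integrable, the function is its primitive, and the values at the endpoints of
the edges agree at the vertices (continuity on the graph). -/
structure H1 (Γ : MGraph V E) (L : E → ℝ) where
  /-- the function -/
  toFun : E → ℝ → ℂ
  /-- its weak derivative -/
  wderiv : E → ℝ → ℂ
  memLp_wderiv : ∀ e, MemLp (wderiv e) 2 (volume.restrict (Ioc 0 (L e)))
  eq_primitive : ∀ e, ∀ x ∈ Icc 0 (L e), toFun e x = toFun e 0 + ∫ t in (0 : ℝ)..x, wderiv e t
  continuous_at_vertices :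
    ∃ v : V → ℂ, ∀ e, toFun e 0 = v (Γ.src e) ∧ toFun e (L e) = v (Γ.tgt e)

/-- The constant functions in `H¹`. -/
def H1.const (Γ : MGraph V E) (L : E → ℝ) (c : ℂ) : Γ.H1 L where
  toFun := fun _ _ => c
  wderiv := fun _ _ => 0
  memLp_wderiv := fun _ => MemLp.zero'
  eq_primitive := by intros; simp
  continuous_at_vertices := ⟨fun _ => c, fun _ => ⟨rfl, rfl⟩⟩

variable [Fintype E] {Γ : MGraph V E} {L : E → ℝ}

/-- The mass `‖u‖₂²`. -/
noncomputable def H1.mass (u : Γ.H1 L) : ℝ :=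
  ∑ e, ∫ x in (0 : ℝ)..(L e), ‖u.toFun e x‖ ^ 2

/-- The NLS energy `½ ‖u'‖₂² - (1/p) ‖u‖ₚᵖ`. -/
noncomputable def H1.energy (p : ℝ) (u : Γ.H1 L) : ℝ :=
  1 / 2 * (∑ e, ∫ x in (0 : ℝ)..(L e), ‖u.wderiv e x‖ ^ 2)
    - 1 / p * ∑ e, ∫ x in (0 : ℝ)..(L e), ‖u.toFun e x‖ ^ p

/-- The distance of two functions in the `H¹` norm. -/
noncomputable def H1.dist (u w : Γ.H1 L) : ℝ :=
  Real.sqrt ((∑ e, ∫ x in (0 : ℝ)..(L e), ‖u.toFun e x - w.toFun e x‖ ^ 2)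
    + ∑ e, ∫ x in (0 : ℝ)..(L e), ‖u.wderiv e x - w.wderiv e x‖ ^ 2)

/-- `u` is a local minimizer of the energy among the functions of `H¹` with the same mass, with
respect to the `H¹` norm. -/
def H1.IsLocalMinimizer (p : ℝ) (u : Γ.H1 L) : Prop :=
  ∃ ε > 0, ∀ w : Γ.H1 L, w.mass = u.mass → w.dist u < ε → u.energy p ≤ w.energy p

/-- The constant function `κ_μ = √(μ / |𝒢|)` of mass `μ`, where `|𝒢|` is the total length. -/
noncomputable def kappa (Γ : MGraph V E) (L : E → ℝ) (μ : ℝ) : Γ.H1 L :=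
  H1.const Γ L (Real.sqrt (μ / ∑ e, L e) : ℝ)

/-- The threshold mass `μ₁(𝒢, p)`: the constant function `κ_μ` is a local minimizer of the energy at
fixed mass for the masses `μ` below it, and is not for the masses above it. -/
noncomputable def mu1 (Γ : MGraph V E) (L : E → ℝ) (p : ℝ) : ℝ :=
  sSup {μ : ℝ | 0 < μ ∧ (Γ.kappa L μ).IsLocalMinimizer p}

end MGraph

/- Near a constant of density `q = μ / |𝒢|`, substitute `‖w‖² = q (1 + z)`: the mass constraint
becomes `∫ z = 0` and the energy excess is, to second order, a multiple of
`∫ z'² - (p - 2) q ^ ((p - 2) / 2) ∫ z²`. Hence `κ_μ` is a local minimizer as long as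
`(p - 2) q ^ ((p - 2) / 2)` is below the spectral gap of the graph, and for `p = 6` the threshold
mass is `|𝒢| √gap / 2`.

The gap is bounded below by comparison with an interval: if edge weights `ω` make every cut, and in
particular every level set of a function, weigh at least `k`, the coarea formula calibrated by a
semicircle gives `gap ≥ (k π / ∑ ω² L)²`. Weight `1` gives `k = 1`; weight `2` on the bridging
edges and `1` elsewhere gives `k = 2`. The gap is bounded above by `(π / L e)²` for a bridging edge
`e`, on testing with half a period of the cosine on `e`, continued by constants to the two sides. -/

section AbsoluteContinuity

variable {X Y : Type*} [PseudoMetricSpace X] [PseudoMetricSpace Y] {a b x y : ℝ}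

theorem absolutelyContinuousOnInterval_of_dist_le {f : ℝ → X} {g : ℝ → Y} {K : ℝ}
    (hf : AbsolutelyContinuousOnInterval f a b)
    (h : ∀ x ∈ uIcc a b, ∀ y ∈ uIcc a b, dist (g x) (g y) ≤ K * dist (f x) (f y)) :
    AbsolutelyContinuousOnInterval g a b := by
  have hlim := (show Tendsto _ _ _ from hf).const_mul K
  rw [mul_zero] at hlim
  refine squeeze_zero' (Eventually.of_forall fun _ => Finset.sum_nonneg fun _ _ => dist_nonneg)
    (eventually_inf_principal.2 (Eventually.of_forall fun I hI => ?_)) hlim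
  rw [Finset.mul_sum]
  exact Finset.sum_le_sum fun i hi => h _ (hI.1 i hi).1 _ (hI.1 i hi).2

theorem absolutelyContinuousOnInterval_comp_lipschitzOnWith {f : ℝ → X} {φ : X → Y} {s : Set X}
    {K : NNReal} (hf : AbsolutelyContinuousOnInterval f a b) (hφ : LipschitzOnWith K φ s)
    (hs : MapsTo f (uIcc a b) s) : AbsolutelyContinuousOnInterval (fun x => φ (f x)) a b :=
  absolutelyContinuousOnInterval_of_dist_le hf fun _ hx _ hy => hφ.dist_le_mul _ (hs hx) _ (hs hy)

theorem absolutelyContinuousOnInterval_primitive {F : Type*} [NormedAddCommGroup F]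
    [NormedSpace ℝ F] {f g : ℝ → F} (hg : IntervalIntegrable g volume a b)
    (hf : ∀ x ∈ uIcc a b, f x = f a + ∫ t in a..x, g t) :
    AbsolutelyContinuousOnInterval f a b := by
  refine absolutelyContinuousOnInterval_of_dist_le (K := 1)
    (hg.norm.absolutelyContinuousOnInterval_intervalIntegral left_mem_uIcc) fun x hx y hy => ?_
  have hsub : ∀ {z}, z ∈ uIcc a b → IntervalIntegrable g volume a z := fun hz =>
    hg.mono_set (uIcc_subset_uIcc left_mem_uIcc hz)
  rw [one_mul, dist_eq_norm, Real.dist_eq, hf x hx, hf y hy, add_sub_add_left_eq_sub,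
    intervalIntegral.integral_interval_sub_left (hsub hx) (hsub hy),
    intervalIntegral.integral_interval_sub_left (hsub hx).norm (hsub hy).norm]
  exact intervalIntegral.norm_integral_le_abs_integral_norm

theorem abs_deriv_comp_le_of_lipschitzOnWith {F : Type*} [NormedAddCommGroup F] [NormedSpace ℝ F]
    {f : ℝ → F} {φ : F → ℝ} {s : Set F} {K : NNReal} {f' : F} (hφ : LipschitzOnWith K φ s)
    (hf : HasDerivAt f f' x) (hs : ∀ᶠ y in 𝓝 x, f y ∈ s) :
    |deriv (fun y => φ (f y)) x| ≤ K * ‖f'‖ := by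
  by_cases hd : DifferentiableAt ℝ (fun y => φ (f y)) x
  swap
  · rw [deriv_zero_of_not_differentiableAt hd, abs_zero]
    positivity
  have hslope := (hasDerivAt_iff_tendsto_slope.1 hd.hasDerivAt).abs
  have hslope' := (hasDerivAt_iff_tendsto_slope.1 hf).norm.const_mul (K : ℝ)
  refine le_of_tendsto_of_tendsto hslope hslope' ?_
  filter_upwards [nhdsWithin_le_nhds hs] with y hy
  rw [slope_def_module, slope_def_module, norm_smul, smul_eq_mul, abs_mul, Real.norm_eq_abs,
    mul_left_comm]
  gcongr
  simpa only [dist_eq_norm, Real.norm_eq_abs] using hφ.dist_le_mul _ hy _ hs.self_of_nhds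

theorem abs_sub_le_integral_abs_deriv {h : ℝ → ℝ} (hh : AbsolutelyContinuousOnInterval h a b)
    (hx : x ∈ Icc a b) (hy : y ∈ Icc a b) (hxy : x ≤ y) :
    |h y - h x| ≤ ∫ t in x..y, |deriv h t| := by
  have hab : a ≤ b := hx.1.trans hx.2
  rw [← uIcc_of_le hab] at hx hy
  rw [← (hh.mono (uIcc_subset_uIcc hx hy)).integral_deriv_eq_sub]
  exact intervalIntegral.abs_integral_le_integral_abs hxy

theorem abs_sub_add_abs_sub_add_abs_sub_le_integral_abs_deriv {h : ℝ → ℝ}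
    (hh : AbsolutelyContinuousOnInterval h a b) (hx : x ∈ Icc a b) (hy : y ∈ Icc a b)
    (hxy : x ≤ y) :
    |h x - h a| + |h y - h x| + |h b - h y| ≤ ∫ t in a..b, |deriv h t| := by
  have hab : a ≤ b := hx.1.trans hx.2
  have ha : a ∈ Icc a b := left_mem_Icc.2 hab
  have hb : b ∈ Icc a b := right_mem_Icc.2 hab
  have hint : ∀ {c d}, c ∈ Icc a b → d ∈ Icc a b →
      IntervalIntegrable (fun t => |deriv h t|) volume c d := fun hc hd => by
    rw [← uIcc_of_le hab] at hc hd
    exact hh.intervalIntegrable_deriv.abs.mono_set (uIcc_subset_uIcc hc hd)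
  rw [← intervalIntegral.integral_add_adjacent_intervals (hint ha hy) (hint hy hb),
    ← intervalIntegral.integral_add_adjacent_intervals (hint ha hx) (hint hx hy)]
  exact add_le_add (add_le_add (abs_sub_le_integral_abs_deriv hh ha hx hx.1)
    (abs_sub_le_integral_abs_deriv hh hx hy hxy)) (abs_sub_le_integral_abs_deriv hh hy hb hy.2)

theorem two_mul_sub_sub_abs_sub_le_integral_abs_deriv {h : ℝ → ℝ}
    (hh : AbsolutelyContinuousOnInterval h a b) (hx : x ∈ Icc a b) (hy : y ∈ Icc a b) :
    2 * (h x - h y) - |h a - h b| ≤ ∫ t in a..b, |deriv h t| := by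
  rcases le_total x y with hxy | hxy
  · have := abs_sub_add_abs_sub_add_abs_sub_le_integral_abs_deriv hh hx hy hxy
    linarith [le_abs_self (h x - h a), neg_abs_le (h y - h x), le_abs_self (h b - h y),
      le_abs_self (h a - h b)]
  · have := abs_sub_add_abs_sub_add_abs_sub_le_integral_abs_deriv hh hy hx hxy
    linarith [neg_abs_le (h y - h a), le_abs_self (h x - h y), neg_abs_le (h b - h x),
      neg_abs_le (h a - h b)]

theorem abs_deriv_comp_ae_eq {ρ H g : ℝ → ℝ} (hρ : AbsolutelyContinuousOnInterval ρ a b)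
    (hd : ∀ t, HasDerivAt H (g t) t) :
    ∀ᵐ t, t ∈ uIoc a b → |deriv (fun t => H (ρ t)) t| = |g (ρ t)| * |deriv ρ t| := by
  filter_upwards [hρ.ae_differentiableAt] with t ht hmem
  have hcomp : HasDerivAt (fun t => H (ρ t)) (g (ρ t) * deriv ρ t) t :=
    (hd (ρ t)).comp t (ht (uIoc_subset_uIcc hmem)).hasDerivAt
  rw [hcomp.deriv, abs_mul]

theorem calibration_le_integral_sq_deriv {ρ H g : ℝ → ℝ} {K : NNReal} {ω : ℝ}
    (hρ : AbsolutelyContinuousOnInterval ρ a b)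
    (hsq : IntervalIntegrable (fun t => deriv ρ t ^ 2) volume a b)
    (hH : LipschitzWith K H) (hd : ∀ t, HasDerivAt H (g t) t) (hg : Continuous g)
    (hω : 0 ≤ ω) (hx : x ∈ Icc a b) (hy : y ∈ Icc a b) :
    2 * ω * (2 * (H (ρ x) - H (ρ y)) - |H (ρ a) - H (ρ b)|)
      - ω ^ 2 * ∫ t in a..b, g (ρ t) ^ 2 ≤ ∫ t in a..b, deriv ρ t ^ 2 := by
  have hcont : ContinuousOn (fun t => g (ρ t)) (uIcc a b) := hg.comp_continuousOn hρ.continuousOn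
  have hvar := two_mul_sub_sub_abs_sub_le_integral_abs_deriv
    (absolutelyContinuousOnInterval_comp_lipschitzOnWith hρ hH.lipschitzOnWith (mapsTo_univ _ _))
    hx hy
  rw [intervalIntegral.integral_congr_ae (abs_deriv_comp_ae_eq hρ hd)] at hvar
  have hint₁ : IntervalIntegrable (fun t => |g (ρ t)| * |deriv ρ t|) volume a b :=
    hρ.intervalIntegrable_deriv.abs.continuousOn_mul hcont.abs
  have hint₂ : IntervalIntegrable (fun t => g (ρ t) ^ 2) volume a b :=
    (hcont.pow 2).intervalIntegrable
  have hyoung : ∫ t in a..b, (2 * ω * (|g (ρ t)| * |deriv ρ t|) - ω ^ 2 * g (ρ t) ^ 2)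
      ≤ ∫ t in a..b, deriv ρ t ^ 2 := by
    refine intervalIntegral.integral_mono_on (hx.1.trans hx.2)
      ((hint₁.const_mul _).sub (hint₂.const_mul _)) hsq fun t _ => ?_
    nlinarith [sq_nonneg (|deriv ρ t| - ω * |g (ρ t)|), sq_abs (deriv ρ t), sq_abs (g (ρ t))]
  rw [intervalIntegral.integral_sub (hint₁.const_mul _) (hint₂.const_mul _),
    intervalIntegral.integral_const_mul, intervalIntegral.integral_const_mul] at hyoung
  refine le_trans ?_ hyoung
  gcongr

end AbsoluteContinuity

/-- The half-circle profile of centre `c` and radius `A`, extended by zero; its primitive is the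
calibration of the weighted Poincaré inequality. -/
noncomputable def semicircle (c A t : ℝ) : ℝ := √(A ^ 2 - (t - c) ^ 2)

section Semicircle

variable {c A t : ℝ}

theorem continuous_semicircle (c A : ℝ) : Continuous (semicircle c A) := by
  unfold semicircle; fun_prop

theorem semicircle_nonneg (c A t : ℝ) : 0 ≤ semicircle c A t := Real.sqrt_nonneg _

theorem semicircle_sq (h : |t - c| ≤ A) : semicircle c A t ^ 2 = A ^ 2 - (t - c) ^ 2 := by
  refine Real.sq_sqrt (sub_nonneg.2 ?_)
  rw [← sq_abs (t - c)]
  gcongr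

theorem semicircle_le (c A t : ℝ) : semicircle c A t ≤ |A| := by
  rw [semicircle, ← Real.sqrt_sq_eq_abs]
  exact Real.sqrt_le_sqrt (sub_le_self _ (sq_nonneg _))

theorem integral_semicircle (hA : 0 ≤ A) :
    ∫ t in (c - A)..(c + A), semicircle c A t = Real.pi * A ^ 2 / 2 := by
  rcases hA.eq_or_lt with rfl | hA
  · simp
  have hscale : ∀ x : ℝ, semicircle c A (A * x + c) = A * √(1 - x ^ 2) := fun x => by
    rw [semicircle, add_sub_cancel_right, show A ^ 2 - (A * x) ^ 2 = A ^ 2 * (1 - x ^ 2) by ring,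
      Real.sqrt_mul (sq_nonneg A), Real.sqrt_sq hA.le]
  have h := intervalIntegral.integral_comp_mul_add (a := -1) (b := 1) (semicircle c A) hA.ne' c
  simp only [hscale, intervalIntegral.integral_const_mul, integral_sqrt_one_sub_sq,
    smul_eq_mul] at h
  rw [mul_neg_one, mul_one, neg_add_eq_sub, add_comm A c] at h
  field_simp at h
  linarith

theorem hasDerivAt_integral_semicircle (c A t : ℝ) :
    HasDerivAt (fun t => ∫ s in c..t, semicircle c A s) (semicircle c A t) t :=
  (continuous_semicircle c A).integral_hasStrictDerivAt c t |>.hasDerivAt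

theorem lipschitzWith_integral_semicircle (c A : ℝ) :
    LipschitzWith ‖A‖₊ (fun t => ∫ s in c..t, semicircle c A s) := by
  refine lipschitzWith_of_nnnorm_deriv_le
    (fun t => (hasDerivAt_integral_semicircle c A t).differentiableAt) fun t => ?_
  rw [(hasDerivAt_integral_semicircle c A t).deriv, ← NNReal.coe_le_coe, coe_nnnorm, coe_nnnorm,
    Real.norm_of_nonneg (semicircle_nonneg c A t)]
  exact semicircle_le c A t

theorem monotone_integral_semicircle (c A : ℝ) :
    Monotone fun t => ∫ r in c..t, semicircle c A r :=
  monotone_of_deriv_nonneg (fun t => (hasDerivAt_integral_semicircle c A t).differentiableAt)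
    fun t => by
      rw [(hasDerivAt_integral_semicircle c A t).deriv]
      exact semicircle_nonneg c A t

end Semicircle

namespace MGraph

variable {V E : Type*} {Γ : MGraph V E} {L : E → ℝ}

/-- A function on the metric graph that is integrable over every edge. -/
def EdgeIntegrable (L : E → ℝ) (f : E → ℝ → ℝ) : Prop :=
  ∀ e, IntervalIntegrable (f e) volume 0 (L e)

/-- The real-valued elements of `H¹` of the metric graph, without a choice of weak derivative: the
weak derivative is `deriv`, which exists almost everywhere by absolute continuity. -/
structure IsRealH1 (Γ : MGraph V E) (L : E → ℝ) (ρ : E → ℝ → ℝ) : Prop where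
  absolutelyContinuous : ∀ e, AbsolutelyContinuousOnInterval (ρ e) 0 (L e)
  sq_deriv : EdgeIntegrable L fun e t => deriv (ρ e) t ^ 2
  continuous_at_vertices : ∃ h : V → ℝ, ∀ e, ρ e 0 = h (Γ.src e) ∧ ρ e (L e) = h (Γ.tgt e)

namespace IsRealH1

variable {ρ : E → ℝ → ℝ}

theorem continuousOn (hρ : Γ.IsRealH1 L ρ) (e : E) : ContinuousOn (ρ e) (uIcc 0 (L e)) :=
  (hρ.absolutelyContinuous e).continuousOn

theorem edgeIntegrable (hρ : Γ.IsRealH1 L ρ) : EdgeIntegrable L ρ := fun e =>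
  (hρ.continuousOn e).intervalIntegrable

theorem edgeIntegrable_sq (hρ : Γ.IsRealH1 L ρ) : EdgeIntegrable L fun e t => ρ e t ^ 2 := fun e =>
  ((hρ.continuousOn e).pow 2).intervalIntegrable

theorem sub_const (hρ : Γ.IsRealH1 L ρ) (c : ℝ) : Γ.IsRealH1 L fun e t => ρ e t - c := by
  obtain ⟨h, hh⟩ := hρ.continuous_at_vertices
  refine ⟨fun e => ?_, ?_, fun v => h v - c, fun e => ?_⟩
  · exact absolutelyContinuousOnInterval_of_dist_le (K := 1) (hρ.absolutelyContinuous e)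
      fun x _ y _ => by rw [dist_sub_right, one_mul]
  · simpa only [deriv_sub_const_fun] using hρ.sq_deriv
  · simp only [(hh e).1, (hh e).2, and_self]

theorem const_mul (hρ : Γ.IsRealH1 L ρ) (c : ℝ) : Γ.IsRealH1 L fun e t => c * ρ e t := by
  obtain ⟨h, hh⟩ := hρ.continuous_at_vertices
  refine ⟨fun e => (hρ.absolutelyContinuous e).const_mul c, ?_, fun v => c * h v, fun e => ?_⟩
  · simp only [deriv_const_mul_field', mul_pow]
    exact fun e => (hρ.sq_deriv e).const_mul (c ^ 2)
  · simp only [(hh e).1, (hh e).2, and_self]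

end IsRealH1

section GraphIntegral

variable [Fintype E] {f g : E → ℝ → ℝ}

/-- The integral of a function over the metric graph. -/
noncomputable def graphIntegral (L : E → ℝ) (f : E → ℝ → ℝ) : ℝ :=
  ∑ e, ∫ x in (0 : ℝ)..(L e), f e x

theorem graphIntegral_add (hf : EdgeIntegrable L f) (hg : EdgeIntegrable L g) :
    graphIntegral L (fun e x => f e x + g e x) = graphIntegral L f + graphIntegral L g := by
  simp only [graphIntegral, intervalIntegral.integral_add (hf _) (hg _), Finset.sum_add_distrib]

theorem graphIntegral_sub (hf : EdgeIntegrable L f) (hg : EdgeIntegrable L g) :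
    graphIntegral L (fun e x => f e x - g e x) = graphIntegral L f - graphIntegral L g := by
  simp only [graphIntegral, intervalIntegral.integral_sub (hf _) (hg _), Finset.sum_sub_distrib]

theorem graphIntegral_const_mul (c : ℝ) (f : E → ℝ → ℝ) :
    graphIntegral L (fun e x => c * f e x) = c * graphIntegral L f := by
  simp only [graphIntegral, intervalIntegral.integral_const_mul, Finset.mul_sum]

theorem graphIntegral_const (L : E → ℝ) (c : ℝ) :
    graphIntegral L (fun _ _ => c) = c * ∑ e, L e := by
  simp only [graphIntegral, intervalIntegral.integral_const, sub_zero, smul_eq_mul, mul_comm,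
    Finset.mul_sum]

theorem graphIntegral_congr (hL : ∀ e, 0 ≤ L e) (h : ∀ e, ∀ x ∈ Icc 0 (L e), f e x = g e x) :
    graphIntegral L f = graphIntegral L g :=
  Finset.sum_congr rfl fun e _ => intervalIntegral.integral_congr (by
    rw [uIcc_of_le (hL e)]
    exact h e)

theorem graphIntegral_mono (hL : ∀ e, 0 ≤ L e) (hf : EdgeIntegrable L f)
    (hg : EdgeIntegrable L g) (h : ∀ e, ∀ x ∈ Icc 0 (L e), f e x ≤ g e x) :
    graphIntegral L f ≤ graphIntegral L g :=
  Finset.sum_le_sum fun e _ => intervalIntegral.integral_mono_on (hL e) (hf e) (hg e) (h e)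

theorem graphIntegral_nonneg (hL : ∀ e, 0 ≤ L e) (h : ∀ e x, 0 ≤ f e x) :
    0 ≤ graphIntegral L f :=
  Finset.sum_nonneg fun e _ => intervalIntegral.integral_nonneg (hL e) fun x _ => h e x

theorem integral_le_graphIntegral {f : E → ℝ → ℝ} (hL : ∀ e, 0 ≤ L e) (hf : ∀ e x, 0 ≤ f e x)
    (e : E) : ∫ x in (0 : ℝ)..(L e), f e x ≤ graphIntegral L f :=
  Finset.single_le_sum (f := fun e => ∫ x in (0 : ℝ)..(L e), f e x)
    (fun e _ => intervalIntegral.integral_nonneg (hL e) fun x _ => hf e x) (Finset.mem_univ e)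

theorem IsRealH1.graphIntegral_sub_const_sq {ρ : E → ℝ → ℝ} (hρ : Γ.IsRealH1 L ρ) (c : ℝ) :
    graphIntegral L (fun e x => (ρ e x - c) ^ 2) = graphIntegral L (fun e x => ρ e x ^ 2)
      - 2 * c * graphIntegral L ρ + c ^ 2 * ∑ e, L e := by
  have hlin : EdgeIntegrable L fun e x => 2 * c * ρ e x := fun e =>
    (hρ.edgeIntegrable e).const_mul _
  have hconst : EdgeIntegrable L fun _ _ => c ^ 2 := fun _ => intervalIntegrable_const
  rw [← graphIntegral_const_mul, ← graphIntegral_const,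
    ← graphIntegral_sub hρ.edgeIntegrable_sq hlin,
    ← graphIntegral_add (fun e => (hρ.edgeIntegrable_sq e).sub (hlin e)) hconst]
  congr! 3
  ring

end GraphIntegral

section PoincareInequality

variable [Fintype E] {ρ : E → ℝ → ℝ} {s : ℝ}

/-- The Poincaré inequality with constant `s` on the metric graph. -/
def PoincareInequality (Γ : MGraph V E) (L : E → ℝ) (s : ℝ) : Prop :=
  ∀ ρ : E → ℝ → ℝ, Γ.IsRealH1 L ρ → graphIntegral L ρ = 0 →
    s * graphIntegral L (fun e x => ρ e x ^ 2) ≤ graphIntegral L fun e x => deriv (ρ e) x ^ 2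

/-- The best constant in the Poincaré inequality, i.e. the first positive eigenvalue of the
Kirchhoff Laplacian. The supremum is the junk value `0` when every function satisfies every Poincaré
inequality, which a graph of positive length excludes. -/
noncomputable def spectralGap (Γ : MGraph V E) (L : E → ℝ) : ℝ :=
  sSup {s | Γ.PoincareInequality L s}

theorem PoincareInequality.mono (hL : ∀ e, 0 ≤ L e) (h : Γ.PoincareInequality L s) {s' : ℝ}
    (hs : s' ≤ s) : Γ.PoincareInequality L s' := fun ρ hρ h0 =>
  (mul_le_mul_of_nonneg_right hs (graphIntegral_nonneg hL fun _ _ => sq_nonneg _)).trans (h ρ hρ h0)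

theorem poincareInequality_zero (hL : ∀ e, 0 ≤ L e) : Γ.PoincareInequality L 0 := fun ρ _ _ => by
  rw [zero_mul]
  exact graphIntegral_nonneg hL fun _ _ => sq_nonneg _

theorem PoincareInequality.variance_le (h : Γ.PoincareInequality L s) (hρ : Γ.IsRealH1 L ρ)
    (hL : 0 < ∑ e, L e) :
    s * (graphIntegral L (fun e x => ρ e x ^ 2) - graphIntegral L ρ ^ 2 / ∑ e, L e)
      ≤ graphIntegral L fun e x => deriv (ρ e) x ^ 2 := by
  set m := graphIntegral L ρ / ∑ e, L e with hm
  have hmean : graphIntegral L (fun e x => ρ e x - m) = 0 := by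
    rw [graphIntegral_sub hρ.edgeIntegrable fun _ => intervalIntegrable_const, graphIntegral_const,
      hm, div_mul_cancel₀ _ hL.ne', sub_self]
  have key := h _ (hρ.sub_const m) hmean
  rw [hρ.graphIntegral_sub_const_sq] at key
  simp only [deriv_sub_const_fun] at key
  refine le_trans (le_of_eq ?_) key
  rw [hm]
  field_simp
  ring

end PoincareInequality

section Cuts

/-- The edge joins the set `S` with its complement. -/
def Crosses (Γ : MGraph V E) (S : Set V) (e : E) : Prop := ¬ (Γ.src e ∈ S ↔ Γ.tgt e ∈ S)

open Classical in
/-- With the edge weights `ω`, every cut of the metric graph has weight at least `k`; cutting at two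
points of an edge is a cut as well. -/
structure CutWeightGE [Fintype E] (Γ : MGraph V E) (ω : E → ℝ) (k : ℝ) : Prop where
  two_mul : ∀ e, k ≤ 2 * ω e
  sum_crosses : ∀ S : Set V, S.Nonempty → Sᶜ.Nonempty → k ≤ ∑ e with Γ.Crosses S e, ω e

theorem JoinedIn.mem_iff {T : Set E} {S : Set V} (hS : ∀ e ∈ T, ¬ Γ.Crosses S e) {x y : V}
    (h : Γ.JoinedIn T x y) : x ∈ S ↔ y ∈ S := by
  induction h with
  | rel a b h =>
    obtain ⟨e, he, rfl, rfl⟩ := h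
    exact not_not.1 (hS e he)
  | refl => rfl
  | symm _ _ _ ih => exact ih.symm
  | trans _ _ _ _ _ ih ih' => exact ih.trans ih'

theorem exists_crosses_of_joinedIn {T : Set E} (hT : ∀ x y, Γ.JoinedIn T x y) {S : Set V}
    (hS : S.Nonempty) (hS' : Sᶜ.Nonempty) : ∃ e ∈ T, Γ.Crosses S e := by
  by_contra! hc
  obtain ⟨x, hx⟩ := hS
  obtain ⟨y, hy⟩ := hS'
  exact hy (((hT x y).mem_iff hc).1 hx)

open Classical in
/-- The weight `2` on the bridging edges and `1` on the other ones. -/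
noncomputable def bridgeWeight (Γ : MGraph V E) (e : E) : ℝ := if Γ.IsBridging e then 2 else 1

theorem one_le_bridgeWeight (Γ : MGraph V E) (e : E) : 1 ≤ Γ.bridgeWeight e := by
  unfold bridgeWeight; split_ifs <;> norm_num

variable [Fintype E]

theorem IsConnected.cutWeightGE_one (h : Γ.IsConnected) : Γ.CutWeightGE (fun _ => 1) 1 where
  two_mul _ := by norm_num
  sum_crosses S hS hS' := by
    classical
    obtain ⟨e, -, he⟩ := exists_crosses_of_joinedIn h.2 hS hS'
    exact Finset.single_le_sum (f := fun _ => (1 : ℝ)) (fun _ _ => zero_le_one)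
      (Finset.mem_filter.2 ⟨Finset.mem_univ e, he⟩)

theorem IsConnected.cutWeightGE_two (h : Γ.IsConnected) : Γ.CutWeightGE Γ.bridgeWeight 2 where
  two_mul e := by linarith [Γ.one_le_bridgeWeight e]
  sum_crosses S hS hS' := by
    classical
    have hnn : ∀ e, 0 ≤ Γ.bridgeWeight e := fun e => zero_le_one.trans (Γ.one_le_bridgeWeight e)
    obtain ⟨e, -, he⟩ := exists_crosses_of_joinedIn h.2 hS hS'
    by_cases hb : Γ.IsBridging e
    · calc (2 : ℝ) = Γ.bridgeWeight e := (if_pos hb).symm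
        _ ≤ _ := Finset.single_le_sum (fun e _ => hnn e)
          (Finset.mem_filter.2 ⟨Finset.mem_univ e, he⟩)
    · obtain ⟨e', hne, he'⟩ := exists_crosses_of_joinedIn (not_not.1 hb) hS hS'
      calc (2 : ℝ) ≤ Γ.bridgeWeight e' + Γ.bridgeWeight e := by
            linarith [Γ.one_le_bridgeWeight e, Γ.one_le_bridgeWeight e']
        _ = ∑ i ∈ {e', e}, Γ.bridgeWeight i := (Finset.sum_pair hne).symm
        _ ≤ _ := Finset.sum_le_sum_of_subset_of_nonneg
          (by simp [Finset.insert_subset_iff, he, he']) fun e _ _ => hnn e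

theorem CutWeightGE.nonneg {ω : E → ℝ} {k : ℝ} (hcut : Γ.CutWeightGE ω k) (hk : 0 ≤ k) (e : E) :
    0 ≤ ω e := by
  linarith [hcut.two_mul e]

end Cuts

section Coarea

variable {lo hi p q t : ℝ}

/-- The number of times, at least, that a continuous function on an interval takes the value `t`,
for almost all `t`, if its range is `[lo, hi]` and its values at the endpoints are `p` and `q`. -/
noncomputable def levelCount (lo hi p q t : ℝ) : ℝ :=
  2 * (Ioc lo hi).indicator 1 t - (uIoc p q).indicator 1 t

theorem uIoc_subset_Ioc_of_mem (hp : p ∈ Icc lo hi) (hq : q ∈ Icc lo hi) :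
    uIoc p q ⊆ Ioc lo hi :=
  Ioc_subset_Ioc (le_min hp.1 hq.1) (max_le hp.2 hq.2)

theorem levelCount_eq_one (hp : p ∈ Icc lo hi) (hq : q ∈ Icc lo hi) (ht : t ∈ uIoc p q) :
    levelCount lo hi p q t = 1 := by
  rw [levelCount, indicator_of_mem ht, indicator_of_mem (uIoc_subset_Ioc_of_mem hp hq ht)]
  norm_num

theorem levelCount_eq_two (ht : t ∈ Ioc lo hi) (ht' : t ∉ uIoc p q) :
    levelCount lo hi p q t = 2 := by
  rw [levelCount, indicator_of_mem ht, indicator_of_notMem ht']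
  norm_num

theorem levelCount_nonneg (hp : p ∈ Icc lo hi) (hq : q ∈ Icc lo hi) :
    0 ≤ levelCount lo hi p q t := by
  by_cases ht : t ∈ uIoc p q
  · rw [levelCount_eq_one hp hq ht]
    exact zero_le_one
  · rw [levelCount, indicator_of_notMem ht, sub_zero]
    exact mul_nonneg zero_le_two (indicator_nonneg (fun _ _ => zero_le_one) t)

theorem integrable_indicator_Ioc_one (a b : ℝ) :
    Integrable ((Ioc a b).indicator (1 : ℝ → ℝ)) :=
  (integrable_indicator_iff measurableSet_Ioc).2 (integrableOn_const (by simp))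

theorem integrable_levelCount (lo hi p q : ℝ) : Integrable (levelCount lo hi p q) :=
  ((integrable_indicator_Ioc_one _ _).const_mul 2).sub (integrable_indicator_Ioc_one _ _)

theorem integral_levelCount (h : lo ≤ hi) :
    ∫ t, levelCount lo hi p q t = 2 * (hi - lo) - |p - q| := by
  simp only [levelCount, uIoc]
  rw [integral_sub ((integrable_indicator_Ioc_one _ _).const_mul 2)
    (integrable_indicator_Ioc_one _ _), integral_const_mul,
    integral_indicator_one measurableSet_Ioc, integral_indicator_one measurableSet_Ioc,
    Real.volume_real_Ioc_of_le h, Real.volume_real_Ioc_of_le min_le_max, max_sub_min_eq_abs']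

theorem crosses_setOf_le_iff {h : V → ℝ} {e : E} :
    Γ.Crosses {v | t ≤ h v} e ↔ t ∈ uIoc (h (Γ.src e)) (h (Γ.tgt e)) := by
  simp only [Crosses, mem_ofPred_eq, mem_uIoc]
  grind

namespace CutWeightGE

variable [Fintype E] {ω : E → ℝ} {k : ℝ} {h : V → ℝ} {lo hi : E → ℝ}

theorem le_sum_mul_levelCount (hcut : Γ.CutWeightGE ω k) (hk : 0 ≤ k)
    (hsrc : ∀ e, h (Γ.src e) ∈ Icc (lo e) (hi e)) (htgt : ∀ e, h (Γ.tgt e) ∈ Icc (lo e) (hi e))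
    {i j : E} (ht : t ∈ Ioc (lo j) (hi i)) :
    k ≤ ∑ e, ω e * levelCount (lo e) (hi e) (h (Γ.src e)) (h (Γ.tgt e)) t := by
  classical
  have hnn : ∀ e, 0 ≤ ω e * levelCount (lo e) (hi e) (h (Γ.src e)) (h (Γ.tgt e)) t := fun e =>
    mul_nonneg (hcut.nonneg hk e) (levelCount_nonneg (hsrc e) (htgt e))
  have hinside : ∀ e, t ∈ Ioc (lo e) (hi e) → t ∉ uIoc (h (Γ.src e)) (h (Γ.tgt e)) →
      k ≤ ∑ e, ω e * levelCount (lo e) (hi e) (h (Γ.src e)) (h (Γ.tgt e)) t := fun e h₁ h₂ =>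
    calc k ≤ ω e * levelCount (lo e) (hi e) (h (Γ.src e)) (h (Γ.tgt e)) t := by
          rw [levelCount_eq_two h₁ h₂, mul_comm]
          exact hcut.two_mul e
      _ ≤ _ := Finset.single_le_sum (fun e _ => hnn e) (Finset.mem_univ e)
  rcases eq_empty_or_nonempty {v | t ≤ h v} with hS | hS
  · have hlt : ∀ v, h v < t := fun v => not_le.1 (eq_empty_iff_forall_notMem.1 hS v)
    exact hinside i ⟨(hsrc i).1.trans_lt (hlt _), ht.2⟩ fun hc =>
      (max_lt (hlt _) (hlt _)).not_ge hc.2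
  rcases eq_empty_or_nonempty {v | t ≤ h v}ᶜ with hS' | hS'
  · have hle : ∀ v, t ≤ h v := fun v => eq_univ_iff_forall.1 (compl_empty_iff.1 hS') v
    exact hinside j ⟨ht.1, (hle _).trans (hsrc j).2⟩ fun hc => (le_min (hle _) (hle _)).not_gt hc.1
  calc k ≤ ∑ e with Γ.Crosses {v | t ≤ h v} e, ω e := by
        convert hcut.sum_crosses _ hS hS'
    _ = ∑ e with Γ.Crosses {v | t ≤ h v} e,
          ω e * levelCount (lo e) (hi e) (h (Γ.src e)) (h (Γ.tgt e)) t :=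
        Finset.sum_congr rfl fun e he => by
          rw [levelCount_eq_one (hsrc e) (htgt e)
            (crosses_setOf_le_iff.1 (Finset.mem_filter.1 he).2), mul_one]
    _ ≤ _ := Finset.sum_le_sum_of_subset_of_nonneg (Finset.subset_univ _) fun e _ _ => hnn e

theorem mul_sub_le_sum_variation (hcut : Γ.CutWeightGE ω k) (hk : 0 ≤ k)
    (hsrc : ∀ e, h (Γ.src e) ∈ Icc (lo e) (hi e)) (htgt : ∀ e, h (Γ.tgt e) ∈ Icc (lo e) (hi e))
    (i j : E) :
    k * (hi i - lo j) ≤ ∑ e, ω e * (2 * (hi e - lo e) - |h (Γ.src e) - h (Γ.tgt e)|) := by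
  have hint : ∀ e, Integrable fun t =>
      ω e * levelCount (lo e) (hi e) (h (Γ.src e)) (h (Γ.tgt e)) t := fun e =>
    (integrable_levelCount _ _ _ _).const_mul _
  calc k * (hi i - lo j) ≤ k * volume.real (Ioc (lo j) (hi i)) := by
        rw [Real.volume_real_Ioc]
        gcongr
        exact le_max_left _ _
    _ ≤ ∫ t in Ioc (lo j) (hi i),
          ∑ e, ω e * levelCount (lo e) (hi e) (h (Γ.src e)) (h (Γ.tgt e)) t :=
        setIntegral_ge_of_const_le_real measurableSet_Ioc (by simp)
          (fun t ht => hcut.le_sum_mul_levelCount hk hsrc htgt ht)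
          (integrable_finsetSum _ fun e _ => hint e).integrableOn
    _ ≤ ∫ t, ∑ e, ω e * levelCount (lo e) (hi e) (h (Γ.src e)) (h (Γ.tgt e)) t :=
        setIntegral_le_integral (integrable_finsetSum _ fun e _ => hint e)
          (Eventually.of_forall fun t => Finset.sum_nonneg fun e _ =>
            mul_nonneg (hcut.nonneg hk e) (levelCount_nonneg (hsrc e) (htgt e)))
    _ = _ := by
        rw [integral_finsetSum _ fun e _ => hint e]
        simp only [integral_const_mul,
          fun e => integral_levelCount (p := h (Γ.src e)) (q := h (Γ.tgt e))
            ((hsrc e).1.trans (hsrc e).2)]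

end CutWeightGE

end Coarea

section WeightedPoincare

theorem integral_semicircle_comp_sq {ρ : ℝ → ℝ} {a b c A : ℝ} (hab : a ≤ b)
    (hρ : ContinuousOn ρ (uIcc a b)) (hA : ∀ t ∈ Icc a b, |ρ t - c| ≤ A) :
    ∫ t in a..b, semicircle c A (ρ t) ^ 2 = A ^ 2 * (b - a) - ∫ t in a..b, (ρ t - c) ^ 2 := by
  have hint : IntervalIntegrable (fun t => (ρ t - c) ^ 2) volume a b :=
    ((hρ.sub continuousOn_const).pow 2).intervalIntegrable
  calc ∫ t in a..b, semicircle c A (ρ t) ^ 2 = ∫ t in a..b, (A ^ 2 - (ρ t - c) ^ 2) :=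
        intervalIntegral.integral_congr fun t ht => semicircle_sq (hA t (uIcc_of_le hab ▸ ht))
    _ = _ := by
        rw [intervalIntegral.integral_sub intervalIntegrable_const hint,
          intervalIntegral.integral_const, smul_eq_mul, mul_comm]

variable {ρ : E → ℝ → ℝ}

theorem IsRealH1.exists_isMaxOn (hρ : Γ.IsRealH1 L ρ) (hL : ∀ e, 0 ≤ L e) :
    ∃ x : E → ℝ, (∀ e, x e ∈ Icc 0 (L e)) ∧ ∀ e, ∀ t ∈ Icc 0 (L e), ρ e t ≤ ρ e (x e) := by
  have h : ∀ e, ∃ x ∈ Icc 0 (L e), IsMaxOn (ρ e) (Icc 0 (L e)) x := fun e =>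
    isCompact_Icc.exists_isMaxOn (nonempty_Icc.2 (hL e)) (uIcc_of_le (hL e) ▸ hρ.continuousOn e)
  choose x hx hmax using h
  exact ⟨x, hx, hmax⟩

theorem IsRealH1.exists_isMinOn (hρ : Γ.IsRealH1 L ρ) (hL : ∀ e, 0 ≤ L e) :
    ∃ x : E → ℝ, (∀ e, x e ∈ Icc 0 (L e)) ∧ ∀ e, ∀ t ∈ Icc 0 (L e), ρ e (x e) ≤ ρ e t := by
  obtain ⟨x, hx, hmax⟩ := (hρ.const_mul (-1)).exists_isMaxOn hL
  exact ⟨x, hx, fun e t ht => by linarith [hmax e t ht]⟩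

variable [Fintype E] {ω : E → ℝ} {k : ℝ}

theorem IsRealH1.calibration_le (hρ : Γ.IsRealH1 L ρ) (hL : ∀ e, 0 ≤ L e) {c A s : ℝ}
    (hA : ∀ e, ∀ t ∈ Icc 0 (L e), |ρ e t - c| ≤ A) (hs : 0 ≤ s) (hω : ∀ e, 0 ≤ ω e)
    {x y : E → ℝ} (hx : ∀ e, x e ∈ Icc 0 (L e)) (hy : ∀ e, y e ∈ Icc 0 (L e)) {H : ℝ → ℝ}
    (hH : H = fun t => ∫ r in c..t, semicircle c A r) :
    2 * s * ∑ e, ω e * (2 * (H (ρ e (x e)) - H (ρ e (y e))) - |H (ρ e 0) - H (ρ e (L e))|)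
        - s ^ 2 * (A ^ 2 * ∑ e, ω e ^ 2 * L e
          - ∑ e, ω e ^ 2 * ∫ t in (0 : ℝ)..(L e), (ρ e t - c) ^ 2)
      ≤ graphIntegral L fun e t => deriv (ρ e) t ^ 2 := by
  subst hH
  simp only [Finset.mul_sum, ← Finset.sum_sub_distrib]
  refine Finset.sum_le_sum fun e _ => le_trans (le_of_eq ?_)
    (calibration_le_integral_sq_deriv (hρ.absolutelyContinuous e) (hρ.sq_deriv e)
      (lipschitzWith_integral_semicircle c A) (hasDerivAt_integral_semicircle c A)
      (continuous_semicircle c A) (mul_nonneg hs (hω e)) (hx e) (hy e))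
  rw [integral_semicircle_comp_sq (hL e) (hρ.continuousOn e) (hA e)]
  ring

namespace CutWeightGE

theorem mul_sub_le_sum_variation_comp (hcut : Γ.CutWeightGE ω k) (hk : 0 ≤ k)
    (hρ : Γ.IsRealH1 L ρ) (hL : ∀ e, 0 ≤ L e) {H : ℝ → ℝ} (hH : Monotone H) {x y : E → ℝ}
    (hmax : ∀ e, ∀ t ∈ Icc 0 (L e), ρ e t ≤ ρ e (x e))
    (hmin : ∀ e, ∀ t ∈ Icc 0 (L e), ρ e (y e) ≤ ρ e t) (i j : E) :
    k * (H (ρ i (x i)) - H (ρ j (y j))) ≤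
      ∑ e, ω e * (2 * (H (ρ e (x e)) - H (ρ e (y e))) - |H (ρ e 0) - H (ρ e (L e))|) := by
  obtain ⟨h, hh⟩ := hρ.continuous_at_vertices
  have hmem : ∀ e, ∀ t ∈ Icc 0 (L e), H (ρ e t) ∈ Icc (H (ρ e (y e))) (H (ρ e (x e))) :=
    fun e t ht => ⟨hH (hmin e t ht), hH (hmax e t ht)⟩
  have key := hcut.mul_sub_le_sum_variation hk (h := H ∘ h) (lo := fun e => H (ρ e (y e)))
    (hi := fun e => H (ρ e (x e)))
    (fun e => by simpa only [Function.comp, (hh e).1] using hmem e 0 (left_mem_Icc.2 (hL e)))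
    (fun e => by simpa only [Function.comp, (hh e).2] using hmem e _ (right_mem_Icc.2 (hL e))) i j
  simpa only [Function.comp, ← (hh _).1, ← (hh _).2] using key

/- With `H` a primitive of the half-circle of diameter `[min ρ, max ρ]`, the coarea inequality for
`H ∘ ρ` and the calibration by `H` combine into a quadratic in the scaling of `ω` whose discriminant
does not see the radius `A`. -/
theorem weighted_poincare [Nonempty E] (hcut : Γ.CutWeightGE ω k) (hk : 0 < k)
    (hL : ∀ e, 0 < L e) (hρ : Γ.IsRealH1 L ρ) :
    ∃ c : ℝ, (k * Real.pi / ∑ e, ω e ^ 2 * L e) ^ 2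
        * ∑ e, ω e ^ 2 * ∫ t in (0 : ℝ)..(L e), (ρ e t - c) ^ 2
      ≤ graphIntegral L fun e t => deriv (ρ e) t ^ 2 := by
  have hL' : ∀ e, 0 ≤ L e := fun e => (hL e).le
  have hω : ∀ e, 0 < ω e := fun e => by linarith [hcut.two_mul e]
  obtain ⟨x, hx, hmax⟩ := hρ.exists_isMaxOn hL'
  obtain ⟨y, hy, hmin⟩ := hρ.exists_isMinOn hL'
  obtain ⟨i, hi⟩ := Finite.exists_max fun e => ρ e (x e)
  obtain ⟨j, hj⟩ := Finite.exists_min fun e => ρ e (y e)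
  set c := (ρ i (x i) + ρ j (y j)) / 2 with hc
  set A := (ρ i (x i) - ρ j (y j)) / 2 with hA
  have hA0 : 0 ≤ A := by linarith [(hj i).trans (hmin i _ (hx i))]
  have hrange : ∀ e, ∀ t ∈ Icc 0 (L e), |ρ e t - c| ≤ A := fun e t ht => by
    have := (hmax e t ht).trans (hi e)
    have := (hj e).trans (hmin e t ht)
    rw [abs_le]
    constructor <;> linarith
  obtain ⟨H, hH⟩ : ∃ H : ℝ → ℝ, H = fun t => ∫ r in c..t, semicircle c A r := ⟨_, rfl⟩
  have hosc : H (ρ i (x i)) - H (ρ j (y j)) = Real.pi * A ^ 2 / 2 := by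
    have hint : ∀ t, IntervalIntegrable (semicircle c A) volume c t :=
      (continuous_semicircle c A).intervalIntegrable c
    simp only [hH]
    rw [intervalIntegral.integral_interval_sub_left (hint _) (hint _),
      ← integral_semicircle (c := c) hA0]
    congr 1 <;> linarith
  have hcoarea := hcut.mul_sub_le_sum_variation_comp hk.le hρ hL'
    (hH ▸ monotone_integral_semicircle c A) hmax hmin i j
  rw [hosc] at hcoarea
  set W := ∑ e, ω e ^ 2 * L e
  have hW : 0 < W := Finset.sum_pos (fun e _ => mul_pos (pow_pos (hω e) 2) (hL e))
    Finset.univ_nonempty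
  set s := k * Real.pi / W
  have hs : 0 ≤ s := by positivity
  have hsW : s * W = k * Real.pi := div_mul_cancel₀ _ hW.ne'
  have hcal := hρ.calibration_le hL' hrange hs (fun e => (hω e).le) hx hy hH
  refine ⟨c, le_trans ?_ hcal⟩
  have hlevel := mul_le_mul_of_nonneg_left hcoarea (mul_nonneg zero_le_two hs)
  have hquad : 2 * s * (k * (Real.pi * A ^ 2 / 2)) = s ^ 2 * (A ^ 2 * W) := by
    linear_combination -s * A ^ 2 * hsW
  linarith

theorem poincareInequality [Nonempty E] (hcut : Γ.CutWeightGE ω k) (hω : ∀ e, 1 ≤ ω e)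
    (hk : 0 < k) (hL : ∀ e, 0 < L e) :
    Γ.PoincareInequality L ((k * Real.pi / ∑ e, ω e ^ 2 * L e) ^ 2) := by
  intro ρ hρ h0
  have hL' : ∀ e, 0 ≤ L e := fun e => (hL e).le
  obtain ⟨c, hc⟩ := hcut.weighted_poincare hk hL hρ
  refine le_trans (mul_le_mul_of_nonneg_left ?_ (sq_nonneg _)) hc
  calc graphIntegral L (fun e x => ρ e x ^ 2)
      ≤ graphIntegral L fun e x => (ρ e x - c) ^ 2 := by
        rw [hρ.graphIntegral_sub_const_sq, h0, mul_zero, sub_zero]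
        exact le_add_of_nonneg_right
          (mul_nonneg (sq_nonneg c) (Finset.sum_nonneg fun e _ => hL' e))
    _ ≤ _ := Finset.sum_le_sum fun e _ => le_mul_of_one_le_left
        (intervalIntegral.integral_nonneg (hL' e) fun _ _ => sq_nonneg _) (one_le_pow₀ (hω e))

end CutWeightGE

end WeightedPoincare

section Sobolev

namespace H1

theorem intervalIntegrable_norm_wderiv_sq (u : Γ.H1 L) {e : E} (hL : 0 ≤ L e) :
    IntervalIntegrable (fun t => ‖u.wderiv e t‖ ^ 2) volume 0 (L e) :=
  (intervalIntegrable_iff_integrableOn_Ioc_of_le hL).2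
    ((memLp_two_iff_integrable_sq_norm (u.memLp_wderiv e).1).1 (u.memLp_wderiv e))

theorem intervalIntegrable_wderiv (u : Γ.H1 L) {e : E} (hL : 0 ≤ L e) :
    IntervalIntegrable (u.wderiv e) volume 0 (L e) :=
  (intervalIntegrable_iff_integrableOn_Ioc_of_le hL).2 ((u.memLp_wderiv e).integrable one_le_two)

theorem absolutelyContinuous (u : Γ.H1 L) {e : E} (hL : 0 ≤ L e) :
    AbsolutelyContinuousOnInterval (u.toFun e) 0 (L e) :=
  absolutelyContinuousOnInterval_primitive (u.intervalIntegrable_wderiv hL) fun x hx =>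
    u.eq_primitive e x (uIcc_of_le hL ▸ hx)

theorem continuousOn (u : Γ.H1 L) {e : E} (hL : 0 ≤ L e) :
    ContinuousOn (u.toFun e) (uIcc 0 (L e)) :=
  (u.absolutelyContinuous hL).continuousOn

theorem ae_hasDerivAt (u : Γ.H1 L) {e : E} (hL : 0 ≤ L e) :
    ∀ᵐ t, t ∈ Ioo 0 (L e) → HasDerivAt (u.toFun e) (u.wderiv e t) t := by
  filter_upwards [(u.intervalIntegrable_wderiv hL).ae_hasDerivAt_integral] with t ht hmem
  rw [uIcc_of_le hL] at ht
  have hprim := ht (Ioo_subset_Icc_self hmem) 0 (left_mem_Icc.2 hL)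
  refine (hprim.const_add (u.toFun e 0)).congr_of_eventuallyEq ?_
  filter_upwards [Icc_mem_nhds hmem.1 hmem.2] with x hx
  exact u.eq_primitive e x hx

section Composition

variable {φ : ℂ → ℝ} {s : Set ℂ} {K : NNReal}

theorem ae_sq_deriv_comp_le (u : Γ.H1 L) {e : E} (hL : 0 ≤ L e) (hφ : LipschitzOnWith K φ s)
    (hs : MapsTo (u.toFun e) (Icc 0 (L e)) s) :
    ∀ᵐ t ∂volume.restrict (Ioc 0 (L e)),
      deriv (fun x => φ (u.toFun e x)) t ^ 2 ≤ K ^ 2 * ‖u.wderiv e t‖ ^ 2 := by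
  rw [← Measure.restrict_congr_set Ioo_ae_eq_Ioc, ae_restrict_iff' measurableSet_Ioo]
  filter_upwards [u.ae_hasDerivAt hL] with t ht hmem
  have hev : ∀ᶠ x in 𝓝 t, u.toFun e x ∈ s :=
    mem_of_superset (Icc_mem_nhds hmem.1 hmem.2) hs
  rw [← mul_pow, ← sq_abs]
  gcongr
  exact abs_deriv_comp_le_of_lipschitzOnWith hφ (ht hmem) hev

theorem isRealH1_comp (u : Γ.H1 L) (hL : ∀ e, 0 ≤ L e) (hφ : LipschitzOnWith K φ s)
    (hs : ∀ e, MapsTo (u.toFun e) (Icc 0 (L e)) s) :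
    Γ.IsRealH1 L fun e x => φ (u.toFun e x) where
  absolutelyContinuous e := absolutelyContinuousOnInterval_comp_lipschitzOnWith
    (u.absolutelyContinuous (hL e)) hφ (uIcc_of_le (hL e) ▸ hs e)
  sq_deriv e := by
    rw [intervalIntegrable_iff_integrableOn_Ioc_of_le (hL e)]
    have hint := ((u.intervalIntegrable_norm_wderiv_sq (hL e)).const_mul (K ^ 2 : ℝ)).1
    refine hint.mono' ((measurable_deriv _).pow_const 2).aestronglyMeasurable ?_
    filter_upwards [u.ae_sq_deriv_comp_le (hL e) hφ (hs e)] with t ht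
    rwa [Real.norm_of_nonneg (sq_nonneg _)]
  continuous_at_vertices := by
    obtain ⟨v, hv⟩ := u.continuous_at_vertices
    exact ⟨φ ∘ v, fun e => by simp only [Function.comp, (hv e).1, (hv e).2, and_self]⟩

theorem graphIntegral_sq_deriv_comp_le [Fintype E] (u : Γ.H1 L) (hL : ∀ e, 0 ≤ L e)
    (hφ : LipschitzOnWith K φ s) (hs : ∀ e, MapsTo (u.toFun e) (Icc 0 (L e)) s) :
    graphIntegral L (fun e => fun t => deriv (fun x => φ (u.toFun e x)) t ^ 2)
      ≤ K ^ 2 * graphIntegral L fun e t => ‖u.wderiv e t‖ ^ 2 := by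
  rw [← graphIntegral_const_mul]
  refine Finset.sum_le_sum fun e _ => ?_
  rw [intervalIntegral.integral_of_le (hL e), intervalIntegral.integral_of_le (hL e)]
  exact integral_mono_ae ((u.isRealH1_comp hL hφ hs).sq_deriv e).1
    ((u.intervalIntegrable_norm_wderiv_sq (hL e)).const_mul _).1
    (u.ae_sq_deriv_comp_le (hL e) hφ (hs e))

end Composition

end H1

/-- A real-valued element of `H¹`, as a complex-valued one. -/
noncomputable def IsRealH1.toH1 {ρ : E → ℝ → ℝ} (hρ : Γ.IsRealH1 L ρ) (hL : ∀ e, 0 ≤ L e) :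
    Γ.H1 L where
  toFun e x := (ρ e x : ℝ)
  wderiv e x := (deriv (ρ e) x : ℝ)
  memLp_wderiv e := MemLp.ofReal <|
    (memLp_two_iff_integrable_sq (measurable_deriv _).aestronglyMeasurable).2 (hρ.sq_deriv e).1
  eq_primitive e x hx := by
    have hsub : uIcc 0 x ⊆ uIcc 0 (L e) := uIcc_subset_uIcc_left (uIcc_of_le (hL e) ▸ hx)
    rw [intervalIntegral.integral_ofReal,
      ((hρ.absolutelyContinuous e).mono hsub).integral_deriv_eq_sub]
    push_cast
    ring
  continuous_at_vertices := by
    obtain ⟨h, hh⟩ := hρ.continuous_at_vertices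
    exact ⟨fun v => h v, fun e => by simp only [(hh e).1, (hh e).2, and_self]⟩

section UniformNorm

theorem integral_le_of_integral_sq_le {f : ℝ → ℝ} {a b ε : ℝ} (hab : a ≤ b) (hε : 0 < ε)
    (hf : IntervalIntegrable f volume a b) (hf2 : IntervalIntegrable (fun t => f t ^ 2) volume a b)
    (h : ∫ t in a..b, f t ^ 2 ≤ ε ^ 2) : ∫ t in a..b, f t ≤ ε * (b - a + 1) / 2 := by
  have hint : ∫ t in a..b, 2 * ε * f t ≤ ∫ t in a..b, (f t ^ 2 + ε ^ 2) :=
    intervalIntegral.integral_mono_on hab (hf.const_mul _) (hf2.add intervalIntegrable_const)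
      fun t _ => by linarith [two_mul_le_add_sq ε (f t)]
  rw [intervalIntegral.integral_const_mul, intervalIntegral.integral_add hf2
    intervalIntegrable_const, intervalIntegral.integral_const, smul_eq_mul] at hint
  have hε2 : 2 * ε * ∫ t in a..b, f t ≤ 2 * ε * (ε * (b - a + 1) / 2) := by linarith
  exact le_of_mul_le_mul_left hε2 (by positivity)

namespace H1

theorem norm_sub_le_integral_norm_wderiv (u : Γ.H1 L) {e : E} (hL : 0 ≤ L e) {x y : ℝ}
    (hx : x ∈ Icc 0 (L e)) (hy : y ∈ Icc 0 (L e)) :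
    ‖u.toFun e x - u.toFun e y‖ ≤ ∫ t in (0 : ℝ)..(L e), ‖u.wderiv e t‖ := by
  have hint := u.intervalIntegrable_wderiv hL
  have hsub : ∀ {z}, z ∈ Icc 0 (L e) → IntervalIntegrable (u.wderiv e) volume 0 z := fun hz =>
    hint.mono_set (uIcc_subset_uIcc_left (by rwa [uIcc_of_le hL]))
  rw [u.eq_primitive e x hx, u.eq_primitive e y hy, add_sub_add_left_eq_sub,
    intervalIntegral.integral_interval_sub_left (hsub hx) (hsub hy),
    intervalIntegral.integral_of_le hL]
  exact intervalIntegral.norm_integral_le_integral_norm_uIoc.trans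
    (setIntegral_mono_set hint.norm.1 (ae_of_all _ fun t => norm_nonneg _)
      (Ioc_subset_Ioc (le_min hy.1 hx.1) (max_le hy.2 hx.2)).eventuallyLE)

theorem norm_sub_le_of_integral_sq_le (u : Γ.H1 L) {e : E} (hL : 0 < L e) (c : ℂ) {ε : ℝ}
    (hε : 0 < ε) (h : ∫ t in (0 : ℝ)..(L e), ‖u.toFun e t - c‖ ^ 2 ≤ ε ^ 2)
    (h' : ∫ t in (0 : ℝ)..(L e), ‖u.wderiv e t‖ ^ 2 ≤ ε ^ 2) {x : ℝ} (hx : x ∈ Icc 0 (L e)) :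
    ‖u.toFun e x - c‖ ≤ ε * ((L e + 1) ^ 2 / (2 * L e)) := by
  have hcont : ContinuousOn (fun t => ‖u.toFun e t - c‖) (uIcc 0 (L e)) :=
    ((u.continuousOn hL.le).sub continuousOn_const).norm
  have hvalue := integral_le_of_integral_sq_le hL.le hε hcont.intervalIntegrable
    (hcont.pow 2).intervalIntegrable h
  have hderiv := integral_le_of_integral_sq_le hL.le hε (u.intervalIntegrable_wderiv hL.le).norm
    (u.intervalIntegrable_norm_wderiv_sq hL.le) h'
  have hmean : ∫ _ in (0 : ℝ)..(L e), ‖u.toFun e x - c‖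
      ≤ ∫ t in (0 : ℝ)..(L e), (‖u.toFun e t - c‖ + ∫ r in (0 : ℝ)..(L e), ‖u.wderiv e r‖) :=
    intervalIntegral.integral_mono_on hL.le intervalIntegrable_const
      (hcont.intervalIntegrable.add intervalIntegrable_const) fun t ht => by
        linarith [norm_sub_le_norm_sub_add_norm_sub (u.toFun e x) (u.toFun e t) c,
          u.norm_sub_le_integral_norm_wderiv hL.le hx ht]
  rw [intervalIntegral.integral_add hcont.intervalIntegrable intervalIntegrable_const,
    intervalIntegral.integral_const, intervalIntegral.integral_const, smul_eq_mul, smul_eq_mul,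
    sub_zero] at hmean
  rw [sub_zero] at hvalue hderiv
  refine le_of_mul_le_mul_left ?_ hL
  calc L e * ‖u.toFun e x - c‖ ≤ ε * (L e + 1) / 2 + L e * (ε * (L e + 1) / 2) :=
        hmean.trans (by gcongr)
    _ = _ := by field_simp; ring

variable [Fintype E]

theorem dist_const_sq (hL : ∀ e, 0 ≤ L e) (w : Γ.H1 L) (c : ℂ) :
    w.dist (H1.const Γ L c) ^ 2 = graphIntegral L (fun e x => ‖w.toFun e x - c‖ ^ 2)
      + graphIntegral L (fun e x => ‖w.wderiv e x‖ ^ 2) := by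
  rw [H1.dist, Real.sq_sqrt]
  · simp only [H1.const, sub_zero, graphIntegral]
  · exact add_nonneg (graphIntegral_nonneg hL fun _ _ => sq_nonneg _)
      (graphIntegral_nonneg hL fun _ _ => sq_nonneg _)

theorem eventually_forall_of_dist_lt (hL : ∀ e, 0 < L e) {c : ℂ} {P : ℂ → Prop}
    (hP : ∀ᶠ v in 𝓝 c, P v) :
    ∃ ε > 0, ∀ w : Γ.H1 L, w.dist (H1.const Γ L c) < ε →
      ∀ e, ∀ x ∈ Icc 0 (L e), P (w.toFun e x) := by
  have hL' : ∀ e, 0 ≤ L e := fun e => (hL e).le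
  obtain ⟨r, hr, hball⟩ := Metric.eventually_nhds_iff.1 hP
  have hsmall : ∀ᶠ ε in 𝓝[>] (0 : ℝ), ∀ e, ε * ((L e + 1) ^ 2 / (2 * L e)) < r :=
    eventually_all.2 fun e => nhdsWithin_le_nhds <|
      (continuous_mul_const _).tendsto' 0 0 (zero_mul _) |>.eventually_lt_const hr
  obtain ⟨ε, hεr, hε⟩ := (hsmall.and self_mem_nhdsWithin).exists
  refine ⟨ε, hε, fun w hw e x hx => hball ?_⟩
  have hsq : w.dist (H1.const Γ L c) ^ 2 ≤ ε ^ 2 := by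
    have : 0 ≤ w.dist (H1.const Γ L c) := Real.sqrt_nonneg _
    gcongr
  rw [dist_const_sq hL'] at hsq
  have h₁ := graphIntegral_nonneg (f := fun e x => ‖w.toFun e x - c‖ ^ 2) hL' fun _ _ => sq_nonneg _
  have h₂ := graphIntegral_nonneg (f := fun e x => ‖w.wderiv e x‖ ^ 2) hL' fun _ _ => sq_nonneg _
  rw [dist_eq_norm]
  refine (w.norm_sub_le_of_integral_sq_le (hL e) c hε ?_ ?_ hx).trans_lt (hεr e)
  · exact (integral_le_graphIntegral (f := fun e x => ‖w.toFun e x - c‖ ^ 2) hL'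
      (fun _ _ => sq_nonneg _) e).trans (by linarith)
  · exact (integral_le_graphIntegral (f := fun e x => ‖w.wderiv e x‖ ^ 2) hL'
      (fun _ _ => sq_nonneg _) e).trans (by linarith)

end H1

end UniformNorm

end Sobolev

section SecondVariation

open Asymptotics

theorem one_add_rpow_sub_taylor_isLittleO (a : ℝ) :
    (fun z : ℝ => (1 + z) ^ a - (1 + a * z + a * (a - 1) / 2 * z ^ 2)) =o[𝓝 0] fun z => z ^ 2 := by
  have hcubic := (Real.one_add_rpow_hasFPowerSeriesAt_zero (a := a)).isBigO_sub_partialSum_pow 3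
  have hlt : (fun z : ℝ => ‖z‖ ^ 3) =o[𝓝 0] fun z => z ^ 2 :=
    (isLittleO_pow_pow (by norm_num : 2 < 3)).norm_left.congr_left fun z => norm_pow z 3
  refine (hcubic.trans_isLittleO hlt).congr_left fun z => ?_
  have hchoose : Ring.choose a 2 = a * (a - 1) / 2 := by
    rw [Ring.choose_eq_smul, ← Polynomial.aeval_eq_smeval]
    simp only [Nat.factorial_two, Nat.cast_ofNat, descPochhammer_succ_left, descPochhammer_zero,
      Polynomial.one_comp, mul_one, Polynomial.X_comp, map_mul, Polynomial.aeval_X,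
      Polynomial.aeval_sub, map_one, smul_eq_mul]
    ring
  simp only [zero_add, FormalMultilinearSeries.partialSum, binomialSeries,
    FormalMultilinearSeries.apply_eq_prod_smul_coeff, Finset.prod_const, Finset.card_univ,
    Fintype.card_fin, FormalMultilinearSeries.coeff_ofScalars, smul_eq_mul, Finset.sum_range_succ,
    Finset.range_one, Finset.sum_singleton, pow_zero, Ring.choose_zero_right', mul_one, pow_one,
    Ring.choose_one_right', hchoose, sub_right_inj]
  ring

variable [Fintype E] {q p ε : ℝ} {z : E → ℝ → ℝ}

theorem abs_graphIntegral_le {f g : E → ℝ → ℝ} (hL : ∀ e, 0 ≤ L e) (hf : EdgeIntegrable L f)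
    (hg : EdgeIntegrable L g) (h : ∀ e, ∀ x ∈ Icc 0 (L e), |f e x| ≤ g e x) :
    |graphIntegral L f| ≤ graphIntegral L g :=
  (Finset.abs_sum_le_sum_abs _ _).trans <| Finset.sum_le_sum fun e _ =>
    (intervalIntegral.abs_integral_le_integral_abs (hL e)).trans
      (intervalIntegral.integral_mono_on (hL e) (hf e).abs (hg e) (h e))

theorem IsRealH1.abs_graphIntegral_one_add_rpow_sub_le (hz : Γ.IsRealH1 L z) (hL : ∀ e, 0 ≤ L e)
    {a : ℝ} (ha : 0 ≤ a) (h0 : graphIntegral L z = 0)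
    (h : ∀ e, ∀ x ∈ Icc 0 (L e),
      |(1 + z e x) ^ a - (1 + a * z e x + a * (a - 1) / 2 * z e x ^ 2)| ≤ ε * z e x ^ 2) :
    |graphIntegral L (fun e x => (1 + z e x) ^ a)
        - (∑ e, L e + a * (a - 1) / 2 * graphIntegral L fun e x => z e x ^ 2)|
      ≤ ε * graphIntegral L fun e x => z e x ^ 2 := by
  have hrpow : EdgeIntegrable L fun e x => (1 + z e x) ^ a := fun e =>
    ((continuousOn_const.add (hz.continuousOn e)).rpow_const fun _ _ => .inr ha).intervalIntegrable
  have hlin : EdgeIntegrable L fun e x => 1 + a * z e x := fun e =>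
    intervalIntegrable_const.add ((hz.edgeIntegrable e).const_mul a)
  have hsq : EdgeIntegrable L fun e x => a * (a - 1) / 2 * z e x ^ 2 := fun e =>
    (hz.edgeIntegrable_sq e).const_mul _
  have hpoly : EdgeIntegrable L fun e x => 1 + a * z e x + a * (a - 1) / 2 * z e x ^ 2 := fun e =>
    (hlin e).add (hsq e)
  have hbound := abs_graphIntegral_le hL (fun e => (hrpow e).sub (hpoly e))
    (fun e => (hz.edgeIntegrable_sq e).const_mul ε) h
  rwa [graphIntegral_sub hrpow hpoly, graphIntegral_add hlin hsq,
    graphIntegral_add (fun _ => intervalIntegrable_const) fun e =>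
      (hz.edgeIntegrable e).const_mul a,
    graphIntegral_const, graphIntegral_const_mul, graphIntegral_const_mul, graphIntegral_const_mul,
    h0, mul_zero, add_zero, one_mul] at hbound

namespace H1

theorem mass_const (hq : 0 ≤ q) : (H1.const Γ L (√q : ℝ)).mass = q * ∑ e, L e := by
  rw [← graphIntegral_const]
  simp only [H1.mass, H1.const, graphIntegral, Complex.norm_real, Real.norm_eq_abs, sq_abs,
    Real.sq_sqrt hq]

theorem mass_eq (hL : ∀ e, 0 ≤ L e) (hz : Γ.IsRealH1 L z) {u : Γ.H1 L}
    (hu : ∀ e, ∀ x ∈ Icc 0 (L e), ‖u.toFun e x‖ ^ 2 = q * (1 + z e x)) :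
    u.mass = q * (∑ e, L e + graphIntegral L z) := by
  rw [← one_mul (∑ e, L e), ← graphIntegral_const,
    ← graphIntegral_add (fun _ => intervalIntegrable_const) hz.edgeIntegrable,
    ← graphIntegral_const_mul]
  exact graphIntegral_congr hL hu

theorem energy_const (hq : 0 ≤ q) :
    (H1.const Γ L (√q : ℝ)).energy p = -(1 / p * q ^ (p / 2) * ∑ e, L e) := by
  have hrpow : ‖((√q : ℝ) : ℂ)‖ ^ p = q ^ (p / 2) := by
    rw [Complex.norm_of_nonneg (Real.sqrt_nonneg q), Real.sqrt_eq_rpow, ← Real.rpow_mul hq,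
      one_div_mul_eq_div]
  rw [mul_assoc, ← graphIntegral_const]
  simp only [H1.energy, H1.const, graphIntegral, hrpow, norm_zero]
  simp

theorem abs_energy_sub_secondVariation_le (hL : ∀ e, 0 ≤ L e) (hp : 0 < p) (hq : 0 < q)
    (hz : Γ.IsRealH1 L z) (h0 : graphIntegral L z = 0) {u : Γ.H1 L}
    (hu : ∀ e, ∀ x ∈ Icc 0 (L e), ‖u.toFun e x‖ ^ 2 = q * (1 + z e x))
    (h : ∀ e, ∀ x ∈ Icc 0 (L e), |(1 + z e x) ^ (p / 2)
      - (1 + p / 2 * z e x + p / 2 * (p / 2 - 1) / 2 * z e x ^ 2)| ≤ ε * z e x ^ 2) :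
    |u.energy p - (H1.const Γ L (√q : ℝ)).energy p
        - (1 / 2 * graphIntegral L (fun e x => ‖u.wderiv e x‖ ^ 2)
          - q * q ^ ((p - 2) / 2) * ((p - 2) / 8) * graphIntegral L fun e x => z e x ^ 2)|
      ≤ q * q ^ ((p - 2) / 2) * (ε / p) * graphIntegral L fun e x => z e x ^ 2 := by
  have hrpow : graphIntegral L (fun e x => ‖u.toFun e x‖ ^ p)
      = q ^ (p / 2) * graphIntegral L fun e x => (1 + z e x) ^ (p / 2) := by
    rw [← graphIntegral_const_mul]
    refine graphIntegral_congr hL fun e x hx => ?_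
    have hnn : 0 ≤ 1 + z e x :=
      nonneg_of_mul_nonneg_right (by rw [← hu e x hx]; positivity) hq
    rw [← Real.mul_rpow hq.le hnn, ← hu e x hx, ← Real.rpow_natCast_mul (norm_nonneg _)]
    congr 1
    push_cast
    ring
  have hpow : q ^ (p / 2) = q * q ^ ((p - 2) / 2) := by
    rw [← Real.rpow_one_add' hq.le (by linarith)]
    congr 1
    ring
  have henergy : u.energy p = 1 / 2 * graphIntegral L (fun e x => ‖u.wderiv e x‖ ^ 2)
      - 1 / p * graphIntegral L fun e x => ‖u.toFun e x‖ ^ p := rfl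
  have hremainder := hz.abs_graphIntegral_one_add_rpow_sub_le hL (by positivity) h0 h
  have hfactor : 0 ≤ q ^ (p / 2) / p := by positivity
  rw [henergy, energy_const hq.le, hrpow, abs_sub_comm, ← hpow]
  calc _ = |q ^ (p / 2) / p * (graphIntegral L (fun e x => (1 + z e x) ^ (p / 2))
          - (∑ e, L e + p / 2 * (p / 2 - 1) / 2 * graphIntegral L fun e x => z e x ^ 2))| := by
        congr 1
        field_simp
        ring
    _ ≤ _ := by
        rw [abs_mul, abs_of_nonneg hfactor]
        refine (mul_le_mul_of_nonneg_left hremainder hfactor).trans_eq ?_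
        ring

end H1

end SecondVariation

section LocalMinimizer

variable {q δ : ℝ}

theorem lipschitzOnWith_norm_sq_div_sub_one (hq : 0 < q) {R : ℝ} (hR : 0 ≤ R) :
    LipschitzOnWith (2 * R / q).toNNReal (fun v : ℂ => ‖v‖ ^ 2 / q - 1) {v | ‖v‖ ≤ R} := by
  refine LipschitzOnWith.of_dist_le_mul fun v (hv : ‖v‖ ≤ R) w (hw : ‖w‖ ≤ R) => ?_
  rw [Real.coe_toNNReal _ (by positivity), dist_eq_norm v w, dist_sub_right, Real.dist_eq,
    ← sub_div, abs_div, abs_of_pos hq, sq_sub_sq, abs_mul, abs_of_nonneg (by positivity),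
    div_mul_eq_mul_div]
  gcongr
  · linarith
  · exact abs_norm_sub_norm_le v w

theorem lipschitzOnWith_sqrt_mul_one_add_re (hq : 0 < q) (hδ : δ < 1) :
    LipschitzOnWith (q / (2 * √(q * (1 - δ)))).toNNReal (fun v : ℂ => √(q * (1 + v.re)))
      {v | -δ ≤ v.re} := by
  refine LipschitzOnWith.of_dist_le_mul fun v (hv : -δ ≤ v.re) w (hw : -δ ≤ w.re) => ?_
  have : 0 < q * (1 - δ) := mul_pos hq (sub_pos.2 hδ)
  have hnn : ∀ {x : ℝ}, -δ ≤ x → 0 ≤ q * (1 + x) := fun hx => mul_nonneg hq.le (by linarith)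
  have hle : ∀ {x : ℝ}, -δ ≤ x → √(q * (1 - δ)) ≤ √(q * (1 + x)) := fun hx => by
    gcongr
    linarith
  rw [Real.coe_toNNReal _ (by positivity), div_mul_eq_mul_div, le_div_iff₀ (by positivity),
    Real.dist_eq, dist_eq_norm]
  calc |√(q * (1 + v.re)) - √(q * (1 + w.re))| * (2 * √(q * (1 - δ)))
      ≤ |√(q * (1 + v.re)) - √(q * (1 + w.re))| * (√(q * (1 + v.re)) + √(q * (1 + w.re))) := by
        gcongr
        linarith [hle hv, hle hw]
    _ = |√(q * (1 + v.re)) ^ 2 - √(q * (1 + w.re)) ^ 2| := by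
        rw [sq_sub_sq, abs_mul, abs_of_nonneg (a := √_ + √_) (by positivity), mul_comm]
    _ = q * |(v - w).re| := by
        rw [Real.sq_sqrt (hnn hv), Real.sq_sqrt (hnn hw), ← mul_sub, add_sub_add_left_eq_sub,
          abs_mul, abs_of_pos hq, Complex.sub_re]
    _ ≤ q * ‖v - w‖ := by
        gcongr
        exact Complex.abs_re_le_norm _

theorem IsRealH1.eventually_forall_mul [Finite E] {ψ : E → ℝ → ℝ} (hψ : Γ.IsRealH1 L ψ)
    (hL : ∀ e, 0 ≤ L e) {Q : ℝ → Prop} (hQ : ∀ᶠ y in 𝓝 0, Q y) :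
    ∀ᶠ t in 𝓝 (0 : ℝ), ∀ e, ∀ x ∈ Icc 0 (L e), Q (t * ψ e x) := by
  obtain ⟨r, hr, hball⟩ := Metric.eventually_nhds_iff.1 hQ
  refine eventually_all.2 fun e => ?_
  obtain ⟨M, hM⟩ := isCompact_Icc.exists_bound_of_continuousOn
    (uIcc_of_le (hL e) ▸ hψ.continuousOn e)
  have hsmall : ∀ᶠ t in 𝓝 (0 : ℝ), ‖t‖ * M < r :=
    Continuous.tendsto' (by fun_prop) 0 0 (by simp) |>.eventually_lt_const hr
  filter_upwards [hsmall] with t ht x hx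
  refine hball ?_
  rw [dist_zero_right, norm_mul]
  exact (mul_le_mul_of_nonneg_left (hM x hx) (norm_nonneg t)).trans_lt ht

variable [Fintype E] {p s : ℝ} {ψ : E → ℝ → ℝ}

theorem H1.graphIntegral_sq_deriv_norm_sq_div_le (hL : ∀ e, 0 ≤ L e) (hq : 0 < q) (hδ : 0 ≤ δ)
    {w : Γ.H1 L} (hw : ∀ e, ∀ x ∈ Icc 0 (L e), ‖w.toFun e x‖ ≤ √(q * (1 + δ))) :
    graphIntegral L (fun e x => deriv (fun y => ‖w.toFun e y‖ ^ 2 / q - 1) x ^ 2)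
      ≤ 4 * (1 + δ) / q * graphIntegral L fun e x => ‖w.wderiv e x‖ ^ 2 := by
  have hlip := lipschitzOnWith_norm_sq_div_sub_one hq (Real.sqrt_nonneg (q * (1 + δ)))
  refine (w.graphIntegral_sq_deriv_comp_le hL hlip hw).trans_eq ?_
  rw [Real.coe_toNNReal _ (by positivity), div_pow, mul_pow, Real.sq_sqrt (by positivity)]
  field_simp
  norm_num [mul_comm]

theorem PoincareInequality.energy_const_le (h : Γ.PoincareInequality L s) (hL : ∀ e, 0 ≤ L e)
    (hp : 0 < p) (hq : 0 < q) (hδ : 0 < δ)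
    (hδs : (p - 2 + 8 * δ / p) * q ^ ((p - 2) / 2) * (1 + δ) ≤ s) {w : Γ.H1 L}
    (hmass : w.mass = q * ∑ e, L e)
    (hw : ∀ e, ∀ x ∈ Icc 0 (L e), ‖w.toFun e x‖ ≤ √(q * (1 + δ))) {z : E → ℝ → ℝ}
    (hz : z = fun e x => ‖w.toFun e x‖ ^ 2 / q - 1)
    (htaylor : ∀ e, ∀ x ∈ Icc 0 (L e), |(1 + z e x) ^ (p / 2)
      - (1 + p / 2 * z e x + p / 2 * (p / 2 - 1) / 2 * z e x ^ 2)| ≤ δ * z e x ^ 2) :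
    (H1.const Γ L (√q : ℝ)).energy p ≤ w.energy p := by
  have hzH1 : Γ.IsRealH1 L z := hz ▸ w.isRealH1_comp hL
    (lipschitzOnWith_norm_sq_div_sub_one hq (Real.sqrt_nonneg _)) hw
  have hdensity : ∀ e, ∀ x ∈ Icc 0 (L e), ‖w.toFun e x‖ ^ 2 = q * (1 + z e x) := fun e x _ => by
    rw [hz]
    field_simp
    ring
  have h0 : graphIntegral L z = 0 := by
    rw [H1.mass_eq hL hzH1 hdensity] at hmass
    linarith [mul_left_cancel₀ hq.ne' hmass]
  have hderiv : s * graphIntegral L (fun e x => z e x ^ 2)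
      ≤ 4 * (1 + δ) / q * graphIntegral L fun e x => ‖w.wderiv e x‖ ^ 2 := by
    refine (h z hzH1 h0).trans ?_
    subst hz
    exact H1.graphIntegral_sq_deriv_norm_sq_div_le hL hq hδ.le hw
  have henergy := H1.abs_energy_sub_secondVariation_le hL hp hq hzH1 h0 hdensity htaylor
  have hP : 0 ≤ graphIntegral L fun e x => z e x ^ 2 :=
    graphIntegral_nonneg hL fun _ _ => sq_nonneg _
  have hcombine := (mul_le_mul_of_nonneg_right hδs hP).trans hderiv
  generalize graphIntegral L (fun e x => ‖w.wderiv e x‖ ^ 2) = D at hcombine henergy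
  generalize graphIntegral L (fun e x => z e x ^ 2) = P at hcombine henergy
  generalize q ^ ((p - 2) / 2) = b at hcombine henergy
  have hquad : q * b * (p - 2 + 8 * δ / p) * P ≤ 4 * D := by
    refine le_of_mul_le_mul_left (a := (1 + δ) / q) ?_ (by positivity)
    calc _ = (p - 2 + 8 * δ / p) * b * (1 + δ) * P := by field_simp
      _ ≤ _ := hcombine
      _ = _ := by ring
  have hsplit : q * b * (p - 2 + 8 * δ / p) * P
      = 8 * (q * b * ((p - 2) / 8) * P + q * b * (δ / p) * P) := by ring
  linarith [(abs_le.1 henergy).1]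

/- The relative mass density `z = ‖w‖² / q - 1` turns the mass constraint into the linear one
`∫ z = 0`, and `∫ z'² ≤ (4 / q + o(1)) ∫ ‖w'‖²`. -/
theorem PoincareInequality.isLocalMinimizer_const (h : Γ.PoincareInequality L s)
    (hL : ∀ e, 0 < L e) (hp : 0 < p) (hq : 0 < q) (hlt : (p - 2) * q ^ ((p - 2) / 2) < s) :
    (H1.const Γ L (√q : ℝ)).IsLocalMinimizer p := by
  obtain ⟨δ, hδs, hδ⟩ : ∃ δ, (p - 2 + 8 * δ / p) * q ^ ((p - 2) / 2) * (1 + δ) < s ∧ 0 < δ := by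
    have hcont : Continuous fun δ : ℝ => (p - 2 + 8 * δ / p) * q ^ ((p - 2) / 2) * (1 + δ) := by
      fun_prop
    have hev := (hcont.tendsto' 0 _ rfl).eventually_lt_const (u := s) (by simpa using hlt)
    exact ((eventually_nhdsWithin_of_eventually_nhds hev).and self_mem_nhdsWithin :
      ∀ᶠ δ in 𝓝[>] (0 : ℝ), _).exists
  have hnorm : ‖((√q : ℝ) : ℂ)‖ = √q := Complex.norm_of_nonneg (Real.sqrt_nonneg q)
  have hz : Tendsto (fun v : ℂ => ‖v‖ ^ 2 / q - 1) (𝓝 (√q : ℝ)) (𝓝 0) :=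
    Continuous.tendsto' (by fun_prop) _ _ <| by
      rw [hnorm, Real.sq_sqrt hq.le, div_self hq.ne', sub_self]
  have hball : ∀ᶠ v in 𝓝 ((√q : ℝ) : ℂ), ‖v‖ ≤ √(q * (1 + δ)) := by
    refine (continuous_norm.tendsto _).eventually_le_const ?_
    rw [hnorm]
    exact Real.sqrt_lt_sqrt hq.le (lt_mul_of_one_lt_right hq (lt_add_of_pos_right 1 hδ))
  have htaylor := hz.eventually ((one_add_rpow_sub_taylor_isLittleO (p / 2)).def hδ)
  simp only [Real.norm_eq_abs, abs_sq] at htaylor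
  obtain ⟨ε, hε, hclose⟩ := H1.eventually_forall_of_dist_lt (Γ := Γ) hL (hball.and htaylor)
  exact ⟨ε, hε, fun w hmass hdist => h.energy_const_le (fun e => (hL e).le) hp hq hδ hδs.le
    (hmass.trans (H1.mass_const hq.le)) (fun e x hx => (hclose w hdist e x hx).1) rfl
    fun e x hx => (hclose w hdist e x hx).2⟩

theorem IsRealH1.eventually_exists_perturbation (hψ : Γ.IsRealH1 L ψ) (hL : ∀ e, 0 ≤ L e)
    (hq : 0 < q) (hδ : 0 < δ) (hδ' : δ < 1) :
    ∀ᶠ t in 𝓝 (0 : ℝ), ∃ w : Γ.H1 L,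
      (∀ e, ∀ x ∈ Icc 0 (L e), ‖w.toFun e x‖ ^ 2 = q * (1 + t * ψ e x)) ∧
      graphIntegral L (fun e x => ‖w.wderiv e x‖ ^ 2)
        ≤ q / (4 * (1 - δ)) * (t ^ 2 * graphIntegral L fun e x => deriv (ψ e) x ^ 2) ∧
      w.dist (H1.const Γ L (√q : ℝ)) ^ 2
        ≤ q / (4 * (1 - δ)) * (t ^ 2 * (graphIntegral L (fun e x => ψ e x ^ 2)
          + graphIntegral L fun e x => deriv (ψ e) x ^ 2)) := by
  filter_upwards [hψ.eventually_forall_mul hL (lt_mem_nhds (neg_neg_of_pos hδ))] with t ht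
  set u := (hψ.const_mul t).toH1 hL
  have hlip := lipschitzOnWith_sqrt_mul_one_add_re hq hδ'
  set K := (q / (2 * √(q * (1 - δ)))).toNNReal
  have hK : (K : ℝ) ^ 2 = q / (4 * (1 - δ)) := by
    have : 0 < q * (1 - δ) := mul_pos hq (sub_pos.2 hδ')
    rw [Real.coe_toNNReal _ (by positivity), div_pow, mul_pow, Real.sq_sqrt this.le]
    field_simp
    norm_num
  have hmaps : ∀ e, MapsTo (u.toFun e) (Icc 0 (L e)) {v | -δ ≤ v.re} := fun e x hx => (ht e x hx).le
  have hw := u.isRealH1_comp hL hlip hmaps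
  have hderiv := u.graphIntegral_sq_deriv_comp_le hL hlip hmaps
  have huderiv : graphIntegral L (fun e x => ‖u.wderiv e x‖ ^ 2)
      = t ^ 2 * graphIntegral L fun e x => deriv (ψ e) x ^ 2 := by
    rw [← graphIntegral_const_mul]
    simp [u, toH1, mul_pow]
  have hvalue : graphIntegral L (fun e x => ‖(hw.toH1 hL).toFun e x - (√q : ℝ)‖ ^ 2)
      ≤ K ^ 2 * (t ^ 2 * graphIntegral L fun e x => ψ e x ^ 2) := by
    rw [← graphIntegral_const_mul, ← graphIntegral_const_mul]
    refine graphIntegral_mono hL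
      (fun e => (((hw.toH1 hL).continuousOn (hL e)).sub continuousOn_const).norm.pow 2
        |>.intervalIntegrable)
      (fun e => ((hψ.edgeIntegrable_sq e).const_mul _).const_mul _) fun e x hx => ?_
    have h0 : (0 : ℂ) ∈ {v : ℂ | -δ ≤ v.re} := by simpa using hδ.le
    have hdist := hlip.dist_le_mul _ (hmaps e hx) 0 h0
    simp only [Complex.zero_re, add_zero, mul_one, dist_zero_right] at hdist
    rw [← mul_pow, ← mul_pow, ← sq_abs (_ * _), abs_mul, NNReal.abs_eq]
    gcongr
    simpa [toH1, u, ← Complex.ofReal_sub, Real.dist_eq] using hdist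
  refine ⟨hw.toH1 hL, fun e x hx => ?_, ?_, ?_⟩
  · simp [toH1, u, Real.sq_sqrt (mul_nonneg hq.le (by linarith [ht e x hx] : 0 ≤ 1 + t * ψ e x))]
  · rw [← hK, ← huderiv]
    simpa [toH1] using hderiv
  · rw [H1.dist_const_sq hL, ← hK, mul_add, mul_add, ← huderiv]
    exact add_le_add hvalue (by simpa [toH1] using hderiv)

theorem IsRealH1.secondVariation_nonneg (hψ : Γ.IsRealH1 L ψ) (hL : ∀ e, 0 ≤ L e) (hp : 0 < p)
    (hq : 0 < q) (h : (H1.const Γ L (√q : ℝ)).IsLocalMinimizer p) (h0 : graphIntegral L ψ = 0)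
    (hδ : 0 < δ) (hδ' : δ < 1) :
    (p - 2 - 8 * δ / p) * q ^ ((p - 2) / 2) * (1 - δ) * graphIntegral L (fun e x => ψ e x ^ 2)
      ≤ graphIntegral L fun e x => deriv (ψ e) x ^ 2 := by
  obtain ⟨ε, hε, hmin⟩ := h
  have htaylor := hψ.eventually_forall_mul hL
    ((one_add_rpow_sub_taylor_isLittleO (p / 2)).def hδ)
  have hdist : ∀ᶠ t in 𝓝 (0 : ℝ), q / (4 * (1 - δ)) * (t ^ 2 * (graphIntegral L
      (fun e x => ψ e x ^ 2) + graphIntegral L fun e x => deriv (ψ e) x ^ 2)) < ε ^ 2 :=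
    Continuous.tendsto' (by fun_prop) 0 0 (by simp) |>.eventually_lt_const (by positivity)
  obtain ⟨t, ⟨⟨w, hdensity, hderiv, hclose⟩, htaylor, hsmall⟩, ht⟩ :=
    ((eventually_nhdsWithin_of_eventually_nhds
      ((hψ.eventually_exists_perturbation hL hq hδ hδ').and (htaylor.and hdist))).and
      self_mem_nhdsWithin : ∀ᶠ t in 𝓝[≠] (0 : ℝ), _).exists
  have hmean : graphIntegral L (fun e x => t * ψ e x) = 0 := by
    rw [graphIntegral_const_mul, h0, mul_zero]
  have hmass : w.mass = (H1.const Γ L (√q : ℝ)).mass := by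
    rw [H1.mass_eq hL (hψ.const_mul t) hdensity, hmean, H1.mass_const hq.le, add_zero]
  have hle := hmin w hmass (lt_of_pow_lt_pow_left₀ 2 hε.le (hclose.trans_lt hsmall))
  have henergy := H1.abs_energy_sub_secondVariation_le hL hp hq (hψ.const_mul t) hmean hdensity
    (ε := δ) fun e x hx => by simpa only [Real.norm_eq_abs, abs_sq] using htaylor e x hx
  simp only [mul_pow, graphIntegral_const_mul] at henergy
  generalize graphIntegral L (fun e x => ψ e x ^ 2) = P at *
  generalize graphIntegral L (fun e x => deriv (ψ e) x ^ 2) = D at *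
  have h1δ : 0 < 1 - δ := sub_pos.2 hδ'
  have ht2 : 0 < t ^ 2 := sq_pos_of_ne_zero ht
  have hcombine : q * q ^ ((p - 2) / 2) * (p - 2 - 8 * δ / p) / 8 * (t ^ 2 * P)
      ≤ 1 / 2 * (q / (4 * (1 - δ)) * (t ^ 2 * D)) := by
    have hsplit : q * q ^ ((p - 2) / 2) * (p - 2 - 8 * δ / p) / 8 * (t ^ 2 * P)
        = q * q ^ ((p - 2) / 2) * ((p - 2) / 8) * (t ^ 2 * P)
          - q * q ^ ((p - 2) / 2) * (δ / p) * (t ^ 2 * P) := by ring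
    linarith [(abs_le.1 henergy).2]
  refine le_of_mul_le_mul_left (a := 1 / 2 * (q / (4 * (1 - δ))) * t ^ 2) ?_ (by positivity)
  calc _ = q * q ^ ((p - 2) / 2) * (p - 2 - 8 * δ / p) / 8 * (t ^ 2 * P) := by
        field_simp
        ring
    _ ≤ _ := hcombine
    _ = _ := by ring

theorem H1.IsLocalMinimizer.poincareInequality (hL : ∀ e, 0 ≤ L e) (hp : 0 < p) (hq : 0 < q)
    (h : (H1.const Γ L (√q : ℝ)).IsLocalMinimizer p) :
    Γ.PoincareInequality L ((p - 2) * q ^ ((p - 2) / 2)) := by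
  intro ψ hψ h0
  have hcont : Continuous fun δ : ℝ => (p - 2 - 8 * δ / p) * q ^ ((p - 2) / 2) * (1 - δ)
      * graphIntegral L fun e x => ψ e x ^ 2 := by fun_prop
  have hlim := (hcont.tendsto' 0 ((p - 2) * q ^ ((p - 2) / 2)
    * graphIntegral L fun e x => ψ e x ^ 2) (by simp)).mono_left (nhdsWithin_le_nhds (s := Ioi 0))
  refine le_of_tendsto hlim ?_
  filter_upwards [Ioo_mem_nhdsGT (zero_lt_one (α := ℝ))] with δ hδ
  exact hψ.secondVariation_nonneg hL hp hq h h0 hδ.1 hδ.2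

end LocalMinimizer

section FarSide

/-- The vertices that are joined to the final vertex of a dart without using its edge. -/
def farSide (Γ : MGraph V E) (d : E × Bool) : Set V := {x | Γ.JoinedIn {d.1}ᶜ (Γ.dartEnd d) x}

theorem dartEnd_mem_farSide (Γ : MGraph V E) (d : E × Bool) : Γ.dartEnd d ∈ Γ.farSide d :=
  Relation.EqvGen.refl _

theorem not_crosses_farSide {d : E × Bool} {f : E} (hf : f ≠ d.1) :
    ¬ Γ.Crosses (Γ.farSide d) f := by
  have h : Γ.JoinedIn {d.1}ᶜ (Γ.src f) (Γ.tgt f) := Relation.EqvGen.rel _ _ ⟨f, hf, rfl, rfl⟩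
  exact not_not.2 ⟨fun h' => h'.trans _ _ _ h, fun h' => h'.trans _ _ _ (h.symm _ _)⟩

theorem JoinedIn.compl_singleton {e : E} (he : Γ.JoinedIn {e}ᶜ (Γ.src e) (Γ.tgt e)) {x y : V}
    (h : Γ.JoinedIn univ x y) : Γ.JoinedIn {e}ᶜ x y := by
  induction h with
  | rel a b h =>
    obtain ⟨f, -, rfl, rfl⟩ := h
    by_cases hf : f = e
    · rwa [hf]
    · exact Relation.EqvGen.rel _ _ ⟨f, hf, rfl, rfl⟩
  | refl => exact Relation.EqvGen.refl _
  | symm _ _ _ ih => exact ih.symm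
  | trans _ _ _ _ _ ih ih' => exact ih.trans _ _ _ ih'

theorem IsBridging.not_joinedIn (hconn : Γ.IsConnected) {e : E} (he : Γ.IsBridging e) :
    ¬ Γ.JoinedIn {e}ᶜ (Γ.src e) (Γ.tgt e) := fun h =>
  he fun x y => h.compl_singleton (hconn.2 x y)

theorem IsBridging.dartStart_notMem_farSide (hconn : Γ.IsConnected) {d : E × Bool}
    (hd : Γ.IsBridging d.1) : Γ.dartStart d ∉ Γ.farSide d := by
  have h := hd.not_joinedIn hconn
  obtain ⟨e, _ | _⟩ := d
  · exact h
  · exact fun h' => h (h'.symm _ _)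

end FarSide

section SpectralGap

variable {ℓ : ℝ} {k : ℕ}

theorem integral_cos_nat_mul_pi_div (hℓ : 0 < ℓ) (hk : k ≠ 0) :
    ∫ x in (0 : ℝ)..ℓ, Real.cos (k * Real.pi / ℓ * x) = 0 := by
  have hc : (k * Real.pi / ℓ : ℝ) ≠ 0 := by positivity
  rw [intervalIntegral.integral_comp_mul_left (fun x => Real.cos x) hc, integral_cos,
    div_mul_cancel₀ _ hℓ.ne', Real.sin_nat_mul_pi, mul_zero, Real.sin_zero, sub_zero, smul_zero]

theorem integral_cos_sq_nat_mul_pi_div (hℓ : 0 < ℓ) (hk : k ≠ 0) :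
    ∫ x in (0 : ℝ)..ℓ, Real.cos (k * Real.pi / ℓ * x) ^ 2 = ℓ / 2 := by
  have hc : (k * Real.pi / ℓ : ℝ) ≠ 0 := by positivity
  rw [intervalIntegral.integral_comp_mul_left (fun x => Real.cos x ^ 2) hc, integral_cos_sq,
    div_mul_cancel₀ _ hℓ.ne', Real.sin_nat_mul_pi]
  simp only [mul_zero, Real.sin_zero, sub_self, zero_add, sub_zero, smul_eq_mul]
  field_simp

theorem integral_sin_sq_nat_mul_pi_div (hℓ : 0 < ℓ) (hk : k ≠ 0) :
    ∫ x in (0 : ℝ)..ℓ, Real.sin (k * Real.pi / ℓ * x) ^ 2 = ℓ / 2 := by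
  have hc : (k * Real.pi / ℓ : ℝ) ≠ 0 := by positivity
  rw [intervalIntegral.integral_comp_mul_left (fun x => Real.sin x ^ 2) hc, integral_sin_sq,
    div_mul_cancel₀ _ hℓ.ne', Real.sin_nat_mul_pi]
  simp only [mul_zero, zero_mul, Real.sin_zero, sub_self, zero_add, sub_zero, smul_eq_mul]
  field_simp

open Classical in
/-- The `k`-th Neumann eigenfunction of the edge `e₀`, continued to every other edge by the value of
`σ` at its initial vertex. -/
noncomputable def cosineOn (Γ : MGraph V E) (L : E → ℝ) (e₀ : E) (k : ℕ) (σ : V → ℝ) (e : E)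
    (x : ℝ) : ℝ :=
  if e = e₀ then Real.cos (k * Real.pi / L e₀ * x) else σ (Γ.src e)

variable {e e₀ : E} {σ : V → ℝ}

theorem cosineOn_self : Γ.cosineOn L e₀ k σ e₀ = fun x => Real.cos (k * Real.pi / L e₀ * x) :=
  funext fun _ => if_pos rfl

theorem cosineOn_of_ne (he : e ≠ e₀) : Γ.cosineOn L e₀ k σ e = fun _ => σ (Γ.src e) :=
  funext fun _ => if_neg he

theorem deriv_cosineOn_self (x : ℝ) : deriv (Γ.cosineOn L e₀ k σ e₀) x
    = -Real.sin (k * Real.pi / L e₀ * x) * (k * Real.pi / L e₀) := by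
  rw [cosineOn_self]
  simpa using ((hasDerivAt_id x).const_mul (k * Real.pi / L e₀)).cos.deriv

theorem contDiff_cosineOn (e : E) : ContDiff ℝ 1 (Γ.cosineOn L e₀ k σ e) := by
  by_cases he : e = e₀
  · rw [he, cosineOn_self]
    fun_prop
  · rw [cosineOn_of_ne he]
    exact contDiff_const

theorem isRealH1_of_contDiff {ρ : E → ℝ → ℝ} (hρ : ∀ e, ContDiff ℝ 1 (ρ e)) {h : V → ℝ}
    (hh : ∀ e, ρ e 0 = h (Γ.src e) ∧ ρ e (L e) = h (Γ.tgt e)) : Γ.IsRealH1 L ρ where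
  absolutelyContinuous e := by
    obtain ⟨K, hK⟩ := (hρ e).contDiffOn.exists_lipschitzOnWith one_ne_zero (convex_uIcc 0 (L e))
      isCompact_uIcc
    exact hK.absolutelyContinuousOnInterval
  sq_deriv e := (((hρ e).continuous_deriv le_rfl).pow 2).intervalIntegrable _ _
  continuous_at_vertices := ⟨h, hh⟩

theorem isRealH1_cosineOn (hL : 0 < L e₀) (hσ : ∀ e ≠ e₀, σ (Γ.src e) = σ (Γ.tgt e))
    (hsrc : σ (Γ.src e₀) = 1) (htgt : σ (Γ.tgt e₀) = (-1) ^ k) :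
    Γ.IsRealH1 L (Γ.cosineOn L e₀ k σ) := by
  refine isRealH1_of_contDiff contDiff_cosineOn (h := σ) fun e => ?_
  by_cases he : e = e₀
  · subst he
    simp only [cosineOn_self, mul_zero, Real.cos_zero, div_mul_cancel₀ _ hL.ne',
      Real.cos_nat_mul_pi, hsrc, htgt, and_self]
  · simp only [cosineOn_of_ne he, hσ e he, and_self]

variable [Fintype E] {s : ℝ}

/- The variance of the test function is at least `ℓ / 2`, where `ℓ` is the length of `e₀`: with `R`
the length of the rest of the graph, `∫ ρ² = ℓ / 2 + R` and `|∫ ρ| ≤ R`. -/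
theorem PoincareInequality.le_sq_nat_mul_pi_div (h : Γ.PoincareInequality L s)
    (hL : ∀ e, 0 < L e) (hk : k ≠ 0) (hσ1 : ∀ v, |σ v| = 1)
    (hσ : ∀ e ≠ e₀, σ (Γ.src e) = σ (Γ.tgt e))
    (hsrc : σ (Γ.src e₀) = 1) (htgt : σ (Γ.tgt e₀) = (-1) ^ k) :
    s ≤ (k * Real.pi / L e₀) ^ 2 := by
  classical
  obtain hs | hs := lt_or_ge s 0
  · exact hs.le.trans (sq_nonneg _)
  have hsplit : ∀ f : E → ℝ, ∑ e, f e = f e₀ + ∑ e ∈ Finset.univ.erase e₀, f e := fun f =>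
    (Finset.add_sum_erase _ _ (Finset.mem_univ e₀)).symm
  set R := ∑ e ∈ Finset.univ.erase e₀, L e
  have hR : 0 ≤ R := Finset.sum_nonneg fun e _ => (hL e).le
  have hmean : |graphIntegral L (Γ.cosineOn L e₀ k σ)| ≤ R := by
    rw [graphIntegral, hsplit, cosineOn_self, integral_cos_nat_mul_pi_div (hL e₀) hk, zero_add]
    refine Finset.abs_sum_le_sum_abs _ _ |>.trans (Finset.sum_le_sum fun e he => ?_)
    rw [cosineOn_of_ne (Finset.ne_of_mem_erase he), intervalIntegral.integral_const, sub_zero,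
      smul_eq_mul, abs_mul, hσ1, mul_one, abs_of_pos (hL e)]
  have hsq : graphIntegral L (fun e x => Γ.cosineOn L e₀ k σ e x ^ 2) = L e₀ / 2 + R := by
    rw [graphIntegral, hsplit, cosineOn_self, integral_cos_sq_nat_mul_pi_div (hL e₀) hk]
    refine congrArg _ (Finset.sum_congr rfl fun e he => ?_)
    rw [cosineOn_of_ne (Finset.ne_of_mem_erase he), intervalIntegral.integral_const, sub_zero,
      smul_eq_mul, ← sq_abs, hσ1, one_pow, mul_one]
  have hderiv : graphIntegral L (fun e x => deriv (Γ.cosineOn L e₀ k σ e) x ^ 2)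
      = (k * Real.pi / L e₀) ^ 2 * (L e₀ / 2) := by
    rw [graphIntegral, hsplit, Finset.sum_eq_zero fun e he => by
      simp [cosineOn_of_ne (Finset.ne_of_mem_erase he)]]
    simp only [deriv_cosineOn_self, mul_pow, neg_sq, intervalIntegral.integral_mul_const,
      integral_sin_sq_nat_mul_pi_div (hL e₀) hk]
    ring
  have hpos : 0 < L e₀ + R := add_pos_of_pos_of_nonneg (hL e₀) hR
  have hvar := h.variance_le (isRealH1_cosineOn (hL e₀) hσ hsrc htgt) (hsplit L ▸ hpos)
  rw [hsq, hderiv, hsplit L] at hvar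
  have hmean_sq : graphIntegral L (Γ.cosineOn L e₀ k σ) ^ 2 / (L e₀ + R) ≤ R := by
    rw [div_le_iff₀ hpos]
    nlinarith [sq_le_sq' (neg_le_of_abs_le hmean) (le_of_abs_le hmean), (hL e₀).le]
  refine le_of_mul_le_mul_right (le_trans ?_ hvar) (half_pos (hL e₀))
  gcongr
  linarith

theorem IsBridging.poincareInequality_le (hconn : Γ.IsConnected) (he : Γ.IsBridging e₀)
    (hL : ∀ e, 0 < L e) (h : Γ.PoincareInequality L s) : s ≤ (Real.pi / L e₀) ^ 2 := by
  classical
  let σ : V → ℝ := fun v => if v ∈ Γ.farSide (e₀, true) then -1 else 1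
  have hσ1 : ∀ v, |σ v| = 1 := fun v => by
    simp only [σ]
    split_ifs <;> simp
  have hσ : ∀ e ≠ e₀, σ (Γ.src e) = σ (Γ.tgt e) := fun e he => by
    simp only [σ, not_not.1 (not_crosses_farSide (Γ := Γ) (d := (e₀, true)) he)]
  simpa using h.le_sq_nat_mul_pi_div hL one_ne_zero hσ1 hσ
    (if_neg (he.dartStart_notMem_farSide hconn (d := (e₀, true))))
    ((if_pos (Γ.dartEnd_mem_farSide (e₀, true))).trans (pow_one (-1)).symm)

theorem PoincareInequality.le_sq_two_mul_pi_div (h : Γ.PoincareInequality L s)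
    (hL : ∀ e, 0 < L e) (e : E) : s ≤ (2 * Real.pi / L e) ^ 2 := by
  simpa using h.le_sq_nat_mul_pi_div hL two_ne_zero (σ := fun _ => 1) (by simp) (by simp) rfl
    (by simp : (1 : ℝ) = (-1) ^ 2)

theorem spectralGap_nonneg (hL : ∀ e, 0 ≤ L e) : 0 ≤ Γ.spectralGap L :=
  Real.sSup_nonneg' ⟨0, poincareInequality_zero hL, le_rfl⟩

theorem poincareInequality_of_lt_spectralGap (hL : ∀ e, 0 ≤ L e) (hs : s < Γ.spectralGap L) :
    Γ.PoincareInequality L s := by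
  obtain ⟨s', hs', hlt⟩ := exists_lt_of_lt_csSup ⟨0, poincareInequality_zero hL⟩ hs
  exact PoincareInequality.mono hL hs' hlt.le

theorem PoincareInequality.le_spectralGap [Nonempty E] (hL : ∀ e, 0 < L e)
    (h : Γ.PoincareInequality L s) : s ≤ Γ.spectralGap L :=
  le_csSup ⟨_, fun _ h' => h'.le_sq_two_mul_pi_div hL (Classical.arbitrary E)⟩ h

theorem IsBridging.spectralGap_le (hconn : Γ.IsConnected) (he : Γ.IsBridging e₀)
    (hL : ∀ e, 0 < L e) : Γ.spectralGap L ≤ (Real.pi / L e₀) ^ 2 :=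
  Real.sSup_le (fun _ h => he.poincareInequality_le hconn hL h) (sq_nonneg _)

end SpectralGap

section ThresholdMass

variable [Fintype E] {p : ℝ}

theorem sub_two_mul_rpow_le_iff (hp : 2 < p) {q s : ℝ} (hq : 0 ≤ q) (hs : 0 ≤ s) :
    (p - 2) * q ^ ((p - 2) / 2) ≤ s ↔ q ≤ (s / (p - 2)) ^ (2 / (p - 2)) := by
  have hp2 : 0 < p - 2 := sub_pos.2 hp
  rw [← inv_div (p - 2) 2, Real.le_rpow_inv_iff_of_pos hq (by positivity) (by positivity),
    le_div_iff₀' hp2]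

theorem sub_two_mul_rpow_lt_iff (hp : 2 < p) {q s : ℝ} (hq : 0 ≤ q) (hs : 0 ≤ s) :
    (p - 2) * q ^ ((p - 2) / 2) < s ↔ q < (s / (p - 2)) ^ (2 / (p - 2)) := by
  have hp2 : 0 < p - 2 := sub_pos.2 hp
  rw [← inv_div (p - 2) 2, Real.lt_rpow_inv_iff_of_pos hq (by positivity) (by positivity),
    lt_div_iff₀' hp2]

theorem mu1_eq [Nonempty E] (hL : ∀ e, 0 < L e) (hp : 2 < p) :
    Γ.mu1 L p = (∑ e, L e) * (Γ.spectralGap L / (p - 2)) ^ (2 / (p - 2)) := by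
  have hLpos : 0 < ∑ e, L e := Finset.sum_pos (fun e _ => hL e) Finset.univ_nonempty
  have hL0 : ∀ e, 0 ≤ L e := fun e => (hL e).le
  have hp0 : 0 < p := by linarith
  have hgap : 0 ≤ Γ.spectralGap L := spectralGap_nonneg hL0
  have hle : ∀ μ ∈ {μ | 0 < μ ∧ (Γ.kappa L μ).IsLocalMinimizer p},
      μ ≤ (∑ e, L e) * (Γ.spectralGap L / (p - 2)) ^ (2 / (p - 2)) := fun μ ⟨hμ, hmin⟩ => by
    have hq : 0 < μ / ∑ e, L e := div_pos hμ hLpos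
    rw [← div_le_iff₀' hLpos, ← sub_two_mul_rpow_le_iff hp hq.le hgap]
    exact (hmin.poincareInequality hL0 hp0 hq).le_spectralGap hL
  refine le_antisymm (Real.sSup_le hle (by have := sub_pos.2 hp; positivity))
    (le_of_forall_lt_imp_le_of_dense fun μ hlt => ?_)
  obtain hμ | hμ := le_or_gt μ 0
  · exact hμ.trans (Real.sSup_nonneg fun _ h => h.1.le)
  have hq : 0 < μ / ∑ e, L e := div_pos hμ hLpos
  rw [← div_lt_iff₀' hLpos, ← sub_two_mul_rpow_lt_iff hp hq.le hgap] at hlt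
  obtain ⟨s, hs, hs'⟩ := exists_between hlt
  exact le_csSup ⟨_, hle⟩ ⟨hμ,
    (poincareInequality_of_lt_spectralGap hL0 hs').isLocalMinimizer_const hL hp0 hq hs⟩

theorem mu1_six [Nonempty E] (hL : ∀ e, 0 < L e) :
    Γ.mu1 L 6 = (∑ e, L e) * √(Γ.spectralGap L) / 2 := by
  rw [mu1_eq hL (by norm_num), show (2 / (6 - 2) : ℝ) = 1 / 2 by norm_num, ← Real.sqrt_eq_rpow,
    show (6 - 2 : ℝ) = 2 ^ 2 by norm_num, Real.sqrt_div' _ (by positivity),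
    Real.sqrt_sq zero_le_two, mul_div_assoc]

theorem IsBridging.mu1_six_le (hconn : Γ.IsConnected) {e : E} (he : Γ.IsBridging e)
    (hL : ∀ e, 0 < L e) : Γ.mu1 L 6 ≤ Real.pi / 2 * ((∑ e, L e) / L e) := by
  have : Nonempty E := ⟨e⟩
  have hLpos : 0 < ∑ e, L e := Finset.sum_pos (fun e _ => hL e) Finset.univ_nonempty
  have hsqrt : √(Γ.spectralGap L) ≤ Real.pi / L e :=
    (Real.sqrt_le_left (div_pos Real.pi_pos (hL e)).le).2 (he.spectralGap_le hconn hL)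
  calc Γ.mu1 L 6 = (∑ e, L e) * √(Γ.spectralGap L) / 2 := mu1_six hL
    _ ≤ (∑ e, L e) * (Real.pi / L e) / 2 := by gcongr
    _ = _ := by ring

theorem CutWeightGE.le_mu1_six [Nonempty E] {ω : E → ℝ} {k : ℝ} (hcut : Γ.CutWeightGE ω k)
    (hω : ∀ e, 1 ≤ ω e) (hk : 0 < k) (hL : ∀ e, 0 < L e) :
    k * Real.pi / 2 * ((∑ e, L e) / ∑ e, ω e ^ 2 * L e) ≤ Γ.mu1 L 6 := by
  have hLpos : 0 < ∑ e, L e := Finset.sum_pos (fun e _ => hL e) Finset.univ_nonempty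
  have hsqrt : k * Real.pi / ∑ e, ω e ^ 2 * L e ≤ √(Γ.spectralGap L) :=
    Real.le_sqrt_of_sq_le ((hcut.poincareInequality hω hk hL).le_spectralGap hL)
  calc _ = (∑ e, L e) * (k * Real.pi / ∑ e, ω e ^ 2 * L e) / 2 := by ring
    _ ≤ (∑ e, L e) * √(Γ.spectralGap L) / 2 := by gcongr
    _ = Γ.mu1 L 6 := (mu1_six hL).symm

end ThresholdMass

section Tree

variable {d d' : E × Bool}

theorem crosses_iff_dart {S : Set V} (d : E × Bool) :
    Γ.Crosses S d.1 ↔ ¬ (Γ.dartStart d ∈ S ↔ Γ.dartEnd d ∈ S) := by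
  obtain ⟨e, _ | _⟩ := d
  · exact not_congr iff_comm
  · exact Iff.rfl

theorem dartStart_reverse (Γ : MGraph V E) (d : E × Bool) :
    Γ.dartStart (d.1, !d.2) = Γ.dartEnd d := by
  obtain ⟨e, _ | _⟩ := d <;> rfl

theorem farSide_ssubset (hconn : Γ.IsConnected) (hd : Γ.IsBridging d.1) (hd' : Γ.IsBridging d'.1)
    (hne : d'.1 ≠ d.1) (h : Γ.dartStart d' = Γ.dartEnd d) : Γ.farSide d' ⊂ Γ.farSide d := by
  have hnear : Γ.dartEnd d ∉ Γ.farSide d' := h ▸ hd'.dartStart_notMem_farSide hconn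
  have hfar : Γ.dartEnd d' ∈ Γ.farSide d :=
    (not_not.1 (mt (crosses_iff_dart d').2 (not_crosses_farSide hne))).1
      (h ▸ Γ.dartEnd_mem_farSide d)
  have hinter : ∀ f ∈ ({d'.1}ᶜ : Set E), ¬ Γ.Crosses (Γ.farSide d' ∩ Γ.farSide d) f := by
    intro f hf
    by_cases hfd : f = d.1
    · rw [hfd, crosses_iff_dart, not_not]
      exact iff_of_false (fun hs => hd.dartStart_notMem_farSide hconn hs.2) fun hs => hnear hs.1
    · exact not_not.2 (and_congr (not_not.1 (not_crosses_farSide hf))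
        (not_not.1 (not_crosses_farSide hfd)))
  have hsub : Γ.farSide d' ⊆ Γ.farSide d := fun x hx =>
    ((JoinedIn.mem_iff hinter hx).1 ⟨Γ.dartEnd_mem_farSide d', hfar⟩).2
  exact ⟨hsub, fun hc => hnear (hc (Γ.dartEnd_mem_farSide d))⟩

theorem degree_dartEnd_eq_one (h : ∀ d', Γ.dartEnd d' = Γ.dartEnd d → d' = d) :
    Γ.degree (Γ.dartEnd d) = 1 := by
  obtain ⟨e, b⟩ := d
  have hdart : ∀ b', {f | Γ.dartEnd (f, b') = Γ.dartEnd (e, b)} = if b' = b then {e} else ∅ := by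
    intro b'
    ext f
    split_ifs with hb
    · exact ⟨fun hf => congrArg Prod.fst (h _ hf), fun hf => by
        rw [hb, mem_singleton_iff.1 hf]; rfl⟩
    · exact ⟨fun hf => hb (congrArg Prod.snd (h _ hf)), False.elim⟩
  have hsrc := hdart false
  have htgt := hdart true
  cases b <;> simp_all [degree, dartEnd]

theorem IsBridging.exists_dart_from_dartEnd (hconn : Γ.IsConnected) (hd : Γ.IsBridging d.1)
    (hterm : ¬ Γ.IsTerminal d.1) : ∃ d' : E × Bool, d'.1 ≠ d.1 ∧ Γ.dartStart d' = Γ.dartEnd d := by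
  by_contra! hno
  have hdeg : Γ.degree (Γ.dartEnd d) = 1 := degree_dartEnd_eq_one fun d' hd' => by
    have hedge : d'.1 = d.1 := by
      by_contra hne
      exact hno (d'.1, !d'.2) hne ((Γ.dartStart_reverse d').trans hd')
    refine Prod.ext hedge (by_contra fun hb => hd.dartStart_notMem_farSide hconn ?_)
    have hreverse : d' = (d.1, !d.2) := Prod.ext hedge (Bool.eq_not_of_ne hb)
    have hloop : Γ.dartStart d = Γ.dartEnd d' := by
      rw [← Γ.dartStart_reverse d', hreverse, Bool.not_not]
    exact hloop ▸ hd' ▸ Γ.dartEnd_mem_farSide d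
  obtain ⟨e, _ | _⟩ := d
  · exact hterm (.inl hdeg)
  · exact hterm (.inr hdeg)

/- A dart with a smallest far side would have a successor with a smaller one. -/
theorem IsConnected.exists_not_isBridging [Finite V] [Finite E] [Nonempty E] (hconn : Γ.IsConnected)
    (hterm : ∀ e, ¬ Γ.IsTerminal e) : ∃ e, ¬ Γ.IsBridging e := by
  by_contra! hall
  obtain ⟨d, hd⟩ := Finite.exists_min fun d : E × Bool => (Γ.farSide d).ncard
  obtain ⟨d', hne, hstart⟩ := (hall d.1).exists_dart_from_dartEnd hconn (hterm d.1)
  exact (hd d').not_gt (ncard_lt_ncard (farSide_ssubset hconn (hall d.1) (hall d'.1) hne hstart))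

end Tree

section Asymptotics

variable [Fintype E] {ι : Type*} {l : Filter ι} {L : ι → E → ℝ}

theorem tendsto_sum_div_of_forall_ne_le {e₀ : ι → E} {K : ℝ} (hL : ∀ᶠ i in l, ∀ e, 0 < L i e)
    (hK : ∀ᶠ i in l, ∀ e ≠ e₀ i, L i e ≤ K) (hlim : Tendsto (fun i => L i (e₀ i)) l atTop) :
    Tendsto (fun i => (∑ e, L i e) / L i (e₀ i)) l (𝓝 1) := by
  classical
  have hupper : Tendsto (fun i => 1 + (Fintype.card E - 1 : ℕ) * K / L i (e₀ i)) l (𝓝 1) := by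
    simpa using (hlim.const_div_atTop ((Fintype.card E - 1 : ℕ) * K)).const_add 1
  refine tendsto_of_tendsto_of_tendsto_of_le_of_le' tendsto_const_nhds hupper ?_ ?_
  · filter_upwards [hL] with i hi
    rw [one_le_div (hi _)]
    exact Finset.single_le_sum (fun e _ => (hi e).le) (Finset.mem_univ _)
  · filter_upwards [hL, hK] with i hi hKi
    have hrest : ∑ e ∈ Finset.univ.erase (e₀ i), L i e ≤ (Fintype.card E - 1 : ℕ) * K := by
      rw [← Finset.card_univ, ← Finset.card_erase_of_mem (Finset.mem_univ (e₀ i)), ← nsmul_eq_mul]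
      exact Finset.sum_le_card_nsmul _ _ K fun e he => hKi e (Finset.ne_of_mem_erase he)
    rw [← Finset.add_sum_erase _ _ (Finset.mem_univ (e₀ i)), add_div, div_self (hi _).ne']
    gcongr
    exact (hi _).le

theorem IsConnected.tendsto_mu1_six (hconn : Γ.IsConnected) (hL : ∀ᶠ i in l, ∀ e, 0 < L i e)
    {e₀ : ι → E} (he₀ : ∀ᶠ i in l, Γ.IsBridging (e₀ i))
    (hratio : Tendsto (fun i => (∑ e, L i e) / L i (e₀ i)) l (𝓝 1)) :
    Tendsto (fun i => Γ.mu1 (L i) 6) l (𝓝 (Real.pi / 2)) := by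
  have hupper : Tendsto (fun i => Real.pi / 2 * ((∑ e, L i e) / L i (e₀ i))) l
      (𝓝 (Real.pi / 2)) := by
    simpa using hratio.const_mul (Real.pi / 2)
  refine tendsto_of_tendsto_of_tendsto_of_le_of_le' tendsto_const_nhds hupper ?_ ?_
  · filter_upwards [hL] with i hi
    have : Nonempty E := ⟨e₀ i⟩
    have hpos : 0 < ∑ e, L i e := Finset.sum_pos (fun e _ => hi e) Finset.univ_nonempty
    simpa [hpos.ne'] using hconn.cutWeightGE_one.le_mu1_six (fun _ => le_rfl) one_pos hi
  · filter_upwards [hL, he₀] with i hi hb using hb.mu1_six_le hconn hi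

theorem IsConnected.pi_le_liminf_mu1_six [l.NeBot] (hconn : Γ.IsConnected)
    (hL : ∀ᶠ i in l, ∀ e, 0 < L i e) {M : E → ℝ} (hM : ∀ e, Tendsto (L · e) l (𝓝 (M e)))
    (hbridge : ∀ e, Γ.IsBridging e → M e = 0) (hne : ∑ e, M e ≠ 0) :
    (Real.pi : EReal) ≤ liminf (fun i => (Γ.mu1 (L i) 6 : EReal)) l := by
  have : Nonempty E := not_isEmpty_iff.1 fun _ => hne (Finset.sum_of_isEmpty _)
  have hweight : ∀ e, Γ.bridgeWeight e ^ 2 * M e = M e := fun e => by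
    by_cases he : Γ.IsBridging e
    · rw [hbridge e he, mul_zero]
    · rw [bridgeWeight, if_neg he, one_pow, one_mul]
  have hratio : Tendsto (fun i => (∑ e, L i e) / ∑ e, Γ.bridgeWeight e ^ 2 * L i e) l (𝓝 1) := by
    have hsum := tendsto_finsetSum Finset.univ fun e _ => hM e
    have hwsum := tendsto_finsetSum Finset.univ fun e _ =>
      (hM e).const_mul (Γ.bridgeWeight e ^ 2)
    simp only [hweight] at hwsum
    exact div_self hne ▸ hsum.div hwsum hne
  have hlim := (continuous_coe_real_ereal.tendsto _).comp
    (hratio.const_mul (2 * Real.pi / 2))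
  rw [mul_one, mul_div_cancel_left₀ _ two_ne_zero] at hlim
  rw [← hlim.liminf_eq]
  refine liminf_le_liminf ?_
  filter_upwards [hL] with i hi
  exact EReal.coe_le_coe (by
    simpa using hconn.cutWeightGE_two.le_mu1_six Γ.one_le_bridgeWeight two_pos hi)

end Asymptotics

end MGraph

theorem theorem4_general {V E : Type*} [Fintype E] (Γ : MGraph V E)
    (hconn : Γ.IsConnected)
    (L : ℝ → E → ℝ)
    (hpos : ∀ ℓ > 0, ∀ e, 0 < L ℓ e)
    (hfix : ∀ e, ¬ Γ.IsBridging e → ∃ c, ∀ ℓ > 0, L ℓ e = c)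
    (hlong : ∀ ℓ > 0, IsGreatest {s | ∃ e, Γ.IsBridging e ∧ L ℓ e = s} ℓ) :
    ((∃ C, ∀ ℓ > 0, ∃ e₀, Γ.IsBridging e₀ ∧ L ℓ e₀ = ℓ ∧
        ∀ e, Γ.IsBridging e → e ≠ e₀ → L ℓ e ≤ C) →
      Tendsto (fun ℓ => Γ.mu1 (L ℓ) 6) atTop (𝓝 (Real.pi / 2))) ∧
    ((∃ e, ¬ Γ.IsBridging e) →
      ((Real.pi : ℝ) : EReal) ≤ liminf (fun ℓ => ((Γ.mu1 (L ℓ) 6 : ℝ) : EReal)) (𝓝[>] 0)) := by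
  classical
  have hconst : ∀ e, ¬ Γ.IsBridging e → ∀ ℓ > 0, L ℓ e = L 1 e := fun e he ℓ hℓ => by
    obtain ⟨c, hc⟩ := hfix e he
    rw [hc ℓ hℓ, hc 1 one_pos]
  constructor
  · rintro ⟨C, hC⟩
    have : Nonempty E := (hlong 1 one_pos).1.nonempty
    choose! e₀ hbridge hlength hother using hC
    have hbdd : ∀ ℓ > 0, ∀ e ≠ e₀ ℓ, L ℓ e ≤ max C (∑ e, L 1 e) := fun ℓ hℓ e he => by
      by_cases hb : Γ.IsBridging e
      · exact le_max_of_le_left (hother ℓ hℓ e hb he)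
      · rw [hconst e hb ℓ hℓ]
        exact le_max_of_le_right (Finset.single_le_sum (fun e _ => (hpos 1 one_pos e).le)
          (Finset.mem_univ e))
    have hev := eventually_gt_atTop (0 : ℝ)
    have hlim : Tendsto (fun ℓ => L ℓ (e₀ ℓ)) atTop atTop :=
      tendsto_id.congr' (hev.mono fun ℓ hℓ => (hlength ℓ hℓ).symm)
    exact hconn.tendsto_mu1_six (hev.mono hpos) (hev.mono hbridge)
      (MGraph.tendsto_sum_div_of_forall_ne_le (hev.mono hpos) (hev.mono hbdd) hlim)
  · rintro ⟨f, hf⟩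
    have hM0 : ∀ e, 0 ≤ if Γ.IsBridging e then 0 else L 1 e := fun e => by
      split_ifs
      exacts [le_rfl, (hpos 1 one_pos e).le]
    refine hconn.pi_le_liminf_mu1_six (M := fun e => if Γ.IsBridging e then 0 else L 1 e)
      (eventually_mem_nhdsWithin.mono hpos) (fun e => ?_) (fun e he => if_pos he) ?_
    · have hev : ∀ᶠ ℓ in 𝓝[>] (0 : ℝ), 0 < ℓ := self_mem_nhdsWithin
      split_ifs with he
      · exact squeeze_zero' (hev.mono fun ℓ hℓ => (hpos ℓ hℓ e).le)
          (hev.mono fun ℓ hℓ => (hlong ℓ hℓ).2 ⟨e, he, rfl⟩) nhdsWithin_le_nhds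
      · exact tendsto_const_nhds.congr' (hev.mono fun ℓ hℓ => (hconst e he ℓ hℓ).symm)
    · refine (Finset.sum_pos' (fun e _ => hM0 e) ⟨f, Finset.mem_univ f, ?_⟩).ne'
      rw [if_neg hf]
      exact hpos 1 one_pos f

theorem theorem4 {V E : Type*} [Fintype V] [Fintype E] (Γ : MGraph V E)
    (hconn : Γ.IsConnected)
    (hterm : ∀ e, ¬ Γ.IsTerminal e)
    (hcyc : ¬ Γ.HasCycleCovering)
    -- the lengths of the edges of `𝒢_ℓ`, for `ℓ > 0`
    (L : ℝ → E → ℝ)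
    (hpos : ∀ ℓ > 0, ∀ e, 0 < L ℓ e)
    -- the rest of the graph does not depend on `ℓ`
    (hfix : ∀ e, ¬ Γ.IsBridging e → ∃ c, ∀ ℓ > 0, L ℓ e = c)
    -- the longest bridging edge has length `ℓ`
    (hlong : ∀ ℓ > 0, IsGreatest {s | ∃ e, Γ.IsBridging e ∧ L ℓ e = s} ℓ) :
    -- for `ℓ → ∞`, the bridging edges other than the longest one (if any) stay bounded
    ((∃ C, ∀ ℓ > 0, ∃ e₀, Γ.IsBridging e₀ ∧ L ℓ e₀ = ℓ ∧
        ∀ e, Γ.IsBridging e → e ≠ e₀ → L ℓ e ≤ C) →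
      Tendsto (fun ℓ => Γ.mu1 (L ℓ) 6) atTop (𝓝 (Real.pi / 2))) ∧
    ((Real.pi : ℝ) : EReal) ≤ liminf (fun ℓ => ((Γ.mu1 (L ℓ) 6 : ℝ) : EReal)) (𝓝[>] 0) := by
  have : Nonempty E := (hlong 1 one_pos).1.nonempty
  exact (theorem4_general Γ hconn L hpos hfix hlong).imp_right fun h =>
    h (hconn.exists_not_isBridging hterm)
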